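/- Let $L^0[0,1]$ be the vector lattice of real Lebesgue measurable functions on $[0,1]$ modulo equality almost everywhere, ordered pointwise a.e. An Orlicz function is a convex, increasing (i.e. non-decreasing), non-constant function $\varphi:[0,\infty)\to[0,\infty)$ with $\varphi(0)=0$; its conjugate is $\varphi^*(s)=\sup\{st-\varphi(t):t\ge 0\}$, $s\ge 0$. The Orlicz space $L^\varphi=L^\varphi[0,1]$ is the Banach lattice of all $f\in L^0[0,1]$ with $$\|f\|_\varphi=\inf\Big\{\lambda>0:\int_0^1\varphi\Big(\frac{|f|}{\lambda}\Big)\,dt\le 1\Big\}<\infty,$$ and the Orlicz heart $H^\varphi$ is the subspace of all $f\in L^\varphi$ with $\int_0^1\varphi(|f|/\lambda)\,dt<\infty$ for every $\lambda>0$, with the norm of $L^\varphi$. The Cesàro sequence of a sequence $(f_n)$ is $\big(\frac1m\sum_{n=1}^m f_n\big)_m$. A sequence $(f_n)$ in a Banach lattice $X$ is order bounded in $X$ if there is $h\in X$, $h\geq 0$, with $|f_n|\le h$ for all $n$. A net $(f_\alpha)$ in $X$ order converges to $f\in X$ if there is a net $(h_\gamma)$ in $X$ with $h_\gamma\downarrow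 0$ such that for every $\gamma$ there is $\alpha_0$ with $|f_\alpha-f|\le h_\gamma$ for all $\alpha\ge\alpha_0$; it $uo$-converges to $f$ if $|f_\alpha-f|\wedge h$ order converges to $0$ for every $h\in X$ with $h\ge 0$. Let $X^*$ be the norm dual of $X$, let $X_n^\sim$ be the set of linear functionals $g$ on $X$ with $g(f_\alpha)\to 0$ whenever $(f_\alpha)$ is a net order converging to $0$, and let $X_{uo}^\sim$ be the set of linear functionals $g$ on $X$ with $g(f_\alpha)\to 0$ whenever $(f_\alpha)$ is a norm bounded net $uo$-converging to $0$. We say that $X$ has $oBSP$ if every norm bounded sequence in $X$ has a subsequence whose Cesàro sequence order converges in $X$. For $I=X^*,\ X_n^\sim,\ X_{uo}^\sim$, we say that $X$ has $w$-$oBSP$, $\sigma_n$-$oBSP$, $\sigma_{uo}$-$oBSP$ respectively if every norm bounded sequence $(f_n)$ in $X$ with $g(f_n)\to 0$ for all $g\in I$ has a subsequence whose Cesàro sequence order converges in $X$. Finally, $\varphi$ has property $(H)$ if every weakly null sequence in $H^\varphi$ has a subsequence whose Cesàro sequence is order bounded in $L^\varphi$. **Theorem.** Let $\varphi$ be an Orlicz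 function such that $\varphi^*(s)<\infty$ for all $s\geq 0$. The following statements are equivalent: 1. $L^\varphi$ has $oBSP$; 2. $L^\varphi$ has $\sigma_{uo}$-$oBSP$; 3. $L^\varphi$ has $\sigma_n$-$oBSP$; 4. $L^\varphi$ has $w$-$oBSP$; 5. $\varphi$ has property $(H)$. -/

import Mathlib

open MeasureTheory Filter Topology Set
open scoped NNReal ENNReal

noncomputable section

/-! ## Order convergence and the dual spaces of a normed lattice -/

section Lattice

universe u

variable {X : Type u} [NormedAddCommGroup X] [NormedSpace ℝ X] [Lattice X]

/-- The net `f`, indexed by a directed set `ι`, order converges to `x`: there is a net decreasing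
to `0` each member of which eventually dominates `|f i - x|`. The decreasing net is given by its
range `D`, a non-empty downward directed set with infimum `0`; conversely every such set is a
decreasing net indexed by itself. -/
def OrderConverges {ι : Type*} [Preorder ι] (f : ι → X) (x : X) : Prop :=
  ∃ D : Set X, D.Nonempty ∧ DirectedOn (· ≥ ·) D ∧ IsGLB D 0 ∧
    ∀ h ∈ D, ∃ i₀, ∀ i, i₀ ≤ i → |f i - x| ≤ h

/-- Unbounded order convergence of a net: `|f i - x| ⊓ h` order converges to `0` for all
`h ≥ 0`. -/
def UOConverges {ι : Type*} [Preorder ι] (f : ι → X) (x : X) : Prop :=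
  ∀ h : X, 0 ≤ h → OrderConverges (fun i => |f i - x| ⊓ h) 0

/-- The range of `f` is contained in some order interval `[-h, h]`. -/
def OrderBounded {ι : Type*} (f : ι → X) : Prop :=
  ∃ h : X, 0 ≤ h ∧ ∀ i, |f i| ≤ h

/-- The range of `f` is bounded in norm. -/
def NormBounded {ι : Type*} (f : ι → X) : Prop :=
  ∃ C : ℝ, ∀ i, ‖f i‖ ≤ C

variable (X) in
/-- The norm dual: all norm continuous linear functionals. -/
def normDual : Set (X →ₗ[ℝ] ℝ) :=
  {g | Continuous g}

variable (X) in
/-- The order continuous dual: all linear functionals that map every order null net to a null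
net. -/
def orderContinuousDual : Set (X →ₗ[ℝ] ℝ) :=
  {g | ∀ (ι : Type u) [Preorder ι] [IsDirectedOrder ι] [Nonempty ι] (f : ι → X),
    OrderConverges f 0 → Tendsto (fun i => g (f i)) atTop (𝓝 0)}

variable (X) in
/-- The `uo`-dual: all linear functionals that map every norm bounded `uo`-null net to a null
net. -/
def uoDual : Set (X →ₗ[ℝ] ℝ) :=
  {g | ∀ (ι : Type u) [Preorder ι] [IsDirectedOrder ι] [Nonempty ι] (f : ι → X),
    NormBounded f → UOConverges f 0 → Tendsto (fun i => g (f i)) atTop (𝓝 0)}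

/-- The sequence `f` converges to `0` in the topology `σ(X, I)`. -/
def SigmaNull {Y : Type*} [AddCommGroup Y] [Module ℝ Y] (I : Set (Y →ₗ[ℝ] ℝ)) (f : ℕ → Y) : Prop :=
  ∀ g ∈ I, Tendsto (fun n => g (f n)) atTop (𝓝 0)

/-- The sequence of Cesàro means `(f 0 + ⋯ + f m) / (m + 1)`. -/
def cesaroMeans {Y : Type*} [AddCommGroup Y] [Module ℝ Y] (f : ℕ → Y) (m : ℕ) : Y :=
  ((m : ℝ) + 1)⁻¹ • ∑ n ∈ Finset.range (m + 1), f n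

variable (X) in
/-- The order Banach-Saks property `oBSP`. -/
def HasOBSP : Prop :=
  ∀ f : ℕ → X, NormBounded f →
    ∃ k : ℕ → ℕ, StrictMono k ∧ ∃ x : X, OrderConverges (cesaroMeans (f ∘ k)) x

/-- The property `σ_I`-`oBSP`. -/
def HasSigmaOBSP (I : Set (X →ₗ[ℝ] ℝ)) : Prop :=
  ∀ f : ℕ → X, NormBounded f → SigmaNull I f →
    ∃ k : ℕ → ℕ, StrictMono k ∧ ∃ x : X, OrderConverges (cesaroMeans (f ∘ k)) x

end Lattice

/-! ## Orlicz spaces on `[0,1]` -/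

/-- The space `L⁰[0,1]` of real measurable functions modulo equality almost everywhere. -/
abbrev L0 : Type := unitInterval →ₘ[volume] ℝ

/-- Orlicz functions `[0,∞) → [0,∞)`: convex, increasing, non-constant and zero at zero. -/
structure OrliczFunction where
  toFun : ℝ≥0 → ℝ≥0
  convexOn : ConvexOn ℝ≥0 Set.univ toFun
  monotone : Monotone toFun
  nonconstant : ∃ s t, toFun s ≠ toFun t
  map_zero : toFun 0 = 0

namespace OrliczFunction

instance : CoeFun OrliczFunction (fun _ => ℝ≥0 → ℝ≥0) := ⟨toFun⟩

/-- The conjugate function `φ*(s) = sup {s t - φ(t) : t ≥ 0}`, with values in `[0,∞]`. -/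
def conj (φ : OrliczFunction) (s : ℝ≥0) : EReal :=
  ⨆ t : ℝ≥0, (((s : ℝ) * t - φ t : ℝ) : EReal)

/-- `∫ φ(|f| / l)` over `[0,1]` for a class `f` of measurable functions and `l > 0`. -/
def modular (φ : OrliczFunction) (l : ℝ≥0) (f : L0) : ℝ≥0∞ :=
  ∫⁻ x, (φ (‖f x‖₊ / l) : ℝ≥0∞)

/-- The Luxemburg norm `inf {l > 0 : ∫ φ(|f| / l) ≤ 1}`, with values in `[0,∞]`. -/
def luxNorm (φ : OrliczFunction) (f : L0) : ℝ≥0∞ :=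
  ⨅ (l : ℝ≥0) (_ : 0 < l ∧ φ.modular l f ≤ 1), (l : ℝ≥0∞)

variable (φ : OrliczFunction)

theorem measurable : Measurable (φ : ℝ≥0 → ℝ≥0) := φ.monotone.measurable

theorem aemeasurable_modular (l : ℝ≥0) (f : L0) :
    AEMeasurable (fun x => (φ (‖f x‖₊ / l) : ℝ≥0∞)) volume := by
  have h : Measurable (fun x => ‖f x‖₊ / l) := f.measurable.nnnorm.div_const l
  exact (measurable_coe_nnreal_ennreal.comp (φ.measurable.comp h)).aemeasurable

theorem modular_mono {f g : L0} (h : ∀ᵐ x, ‖f x‖₊ ≤ ‖g x‖₊) (l : ℝ≥0) :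
    φ.modular l f ≤ φ.modular l g := by
  refine lintegral_mono_ae ?_
  filter_upwards [h] with x hx
  exact_mod_cast φ.monotone (by gcongr)

theorem modular_anti (f : L0) {l m : ℝ≥0} (hl : 0 < l) (h : l ≤ m) :
    φ.modular m f ≤ φ.modular l f := by
  refine lintegral_mono fun x => ?_
  have h1 : ‖f x‖₊ / m ≤ ‖f x‖₊ / l := by gcongr
  exact ENNReal.coe_le_coe.2 (φ.monotone h1)

theorem modular_add {f g : L0} {l m : ℝ≥0} (hl : 0 < l) (hm : 0 < m) :
    φ.modular (l + m) (f + g) ≤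
      (l / (l + m) : ℝ≥0) * φ.modular l f + (m / (l + m) : ℝ≥0) * φ.modular m g := by
  unfold modular
  rw [← lintegral_const_mul'' _ (φ.aemeasurable_modular l f),
    ← lintegral_const_mul'' _ (φ.aemeasurable_modular m g),
    ← lintegral_add_left' ((φ.aemeasurable_modular l f).const_mul _)]
  refine lintegral_mono_ae ?_
  filter_upwards [AEEqFun.coeFn_add f g] with x hx
  have hlm : 0 < l + m := by positivity
  have h1 : ‖(f + g) x‖₊ / (l + m) ≤
      (l / (l + m)) • (‖f x‖₊ / l) + (m / (l + m)) • (‖g x‖₊ / m) := by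
    rw [hx, Pi.add_apply]
    calc ‖f x + g x‖₊ / (l + m) ≤ (‖f x‖₊ + ‖g x‖₊) / (l + m) := by
          gcongr; exact nnnorm_add_le _ _
      _ = _ := by
          simp only [smul_eq_mul]
          field_simp
  have h2 := φ.convexOn.2 (mem_univ (‖f x‖₊ / l)) (mem_univ (‖g x‖₊ / m))
    (zero_le (a := l / (l + m))) (zero_le (a := m / (l + m))) (by field_simp)
  have h3 := (φ.monotone h1).trans h2
  simp only [smul_eq_mul] at h3
  exact_mod_cast h3

theorem modular_smul (c : ℝ) (hc : c ≠ 0) (f : L0) (l : ℝ≥0) :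
    φ.modular (‖c‖₊ * l) (c • f) = φ.modular l f := by
  refine lintegral_congr_ae ?_
  filter_upwards [AEEqFun.coeFn_smul c f] with x hx
  have : ‖c‖₊ ≠ 0 := by simpa using hc
  rw [hx, Pi.smul_apply, nnnorm_smul, mul_div_mul_left _ _ this]

theorem modular_zero (l : ℝ≥0) : φ.modular l 0 = 0 := by
  have : φ.modular l 0 = ∫⁻ _ : unitInterval, 0 := by
    refine lintegral_congr_ae ?_
    filter_upwards [AEEqFun.coeFn_zero (α := unitInterval) (μ := volume) (β := ℝ)] with x hx
    rw [hx]
    simp [φ.map_zero]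
  simpa using this

theorem luxNorm_le {f : L0} {l : ℝ≥0} (hl : 0 < l) (h : φ.modular l f ≤ 1) :
    φ.luxNorm f ≤ l := iInf₂_le l ⟨hl, h⟩

theorem luxNorm_lt_iff {f : L0} {r : ℝ≥0∞} :
    φ.luxNorm f < r ↔ ∃ l : ℝ≥0, 0 < l ∧ φ.modular l f ≤ 1 ∧ (l : ℝ≥0∞) < r := by
  simp only [luxNorm, iInf_lt_iff, exists_prop, and_assoc]

theorem luxNorm_mono {f g : L0} (h : ∀ᵐ x, ‖f x‖₊ ≤ ‖g x‖₊) :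
    φ.luxNorm f ≤ φ.luxNorm g :=
  le_iInf₂ fun _ hl => φ.luxNorm_le hl.1 ((φ.modular_mono h _).trans hl.2)

theorem luxNorm_zero : φ.luxNorm 0 = 0 := by
  refine le_antisymm (le_of_forall_gt fun r hr => ?_) zero_le
  obtain ⟨l, hl0, hl⟩ := ENNReal.lt_iff_exists_nnreal_btwn.1 hr
  exact φ.luxNorm_lt_iff.2 ⟨l, by exact_mod_cast hl0, by simp [modular_zero], hl⟩

theorem luxNorm_add (f g : L0) :
    φ.luxNorm (f + g) ≤ φ.luxNorm f + φ.luxNorm g := by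
  rcases eq_or_ne (φ.luxNorm f) ⊤ with hf | hf
  · simp [hf]
  rcases eq_or_ne (φ.luxNorm g) ⊤ with hg | hg
  · simp [hg]
  refine ENNReal.le_of_forall_pos_le_add fun ε hε _ => ?_
  have hε' : ((ε / 2 : ℝ≥0) : ℝ≥0∞) ≠ 0 := by simpa using hε.ne'
  obtain ⟨l, hl, hl1, hla⟩ := φ.luxNorm_lt_iff.1 (ENNReal.lt_add_right hf hε')
  obtain ⟨m, hm, hm1, hmb⟩ := φ.luxNorm_lt_iff.1 (ENNReal.lt_add_right hg hε')
  have h : φ.modular (l + m) (f + g) ≤ 1 := by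
    refine (φ.modular_add hl hm).trans ?_
    calc _ ≤ ((l / (l + m) : ℝ≥0) : ℝ≥0∞) * 1 + ((m / (l + m) : ℝ≥0) : ℝ≥0∞) * 1 := by
          gcongr
      _ = ((l / (l + m) + m / (l + m) : ℝ≥0) : ℝ≥0∞) := by simp
      _ = 1 := by
          have : l / (l + m) + m / (l + m) = 1 := by field_simp
          simp [this]
  refine (φ.luxNorm_le (by positivity) h).trans ?_
  calc ((l + m : ℝ≥0) : ℝ≥0∞) = l + m := by push_cast; rfl
    _ ≤ (φ.luxNorm f + (ε / 2 : ℝ≥0)) + (φ.luxNorm g + (ε / 2 : ℝ≥0)) := by gcongr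
    _ = φ.luxNorm f + φ.luxNorm g + ((ε / 2 + ε / 2 : ℝ≥0) : ℝ≥0∞) := by push_cast; ring
    _ = φ.luxNorm f + φ.luxNorm g + ε := by rw [add_halves]

theorem luxNorm_smul_le (c : ℝ) (f : L0) :
    φ.luxNorm (c • f) ≤ ‖c‖₊ * φ.luxNorm f := by
  rcases eq_or_ne c 0 with rfl | hc
  · simp [luxNorm_zero]
  have h0 : ‖c‖₊ ≠ 0 := by simpa using hc
  have h0' : (‖c‖₊ : ℝ≥0∞) ≠ 0 := by exact_mod_cast h0
  unfold luxNorm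
  rw [ENNReal.mul_iInf_of_ne h0' ENNReal.coe_ne_top]
  refine le_iInf fun l => ?_
  rw [ENNReal.mul_iInf_of_ne h0' ENNReal.coe_ne_top]
  refine le_iInf fun hl => ?_
  have := φ.luxNorm_le (f := c • f) (l := ‖c‖₊ * l) (mul_pos (pos_iff_ne_zero.2 h0) hl.1)
    (by rw [φ.modular_smul c hc]; exact hl.2)
  exact_mod_cast this

theorem luxNorm_smul (c : ℝ) (f : L0) :
    φ.luxNorm (c • f) = ‖c‖₊ * φ.luxNorm f := by
  refine le_antisymm (φ.luxNorm_smul_le c f) ?_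
  rcases eq_or_ne c 0 with rfl | hc
  · simp
  have h0 : (‖c‖₊ : ℝ≥0∞) ≠ 0 := by simpa using hc
  have h := φ.luxNorm_smul_le c⁻¹ (c • f)
  rw [smul_smul, inv_mul_cancel₀ hc, one_smul] at h
  calc (‖c‖₊ : ℝ≥0∞) * φ.luxNorm f ≤ ‖c‖₊ * (‖c⁻¹‖₊ * φ.luxNorm (c • f)) := by gcongr
    _ = φ.luxNorm (c • f) := by
      rw [← mul_assoc, ← ENNReal.coe_mul, ← nnnorm_mul, mul_inv_cancel₀ hc]; simp

theorem exists_pos : ∃ t, 0 < φ t := by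
  obtain ⟨s, t, h⟩ := φ.nonconstant
  by_contra! hh
  exact h ((nonpos_iff_eq_zero.1 (hh s)).trans (nonpos_iff_eq_zero.1 (hh t)).symm)

theorem natCast_mul_le (n : ℕ) (t : ℝ≥0) : (n : ℝ≥0) * φ t ≤ φ (n * t) := by
  rcases n.eq_zero_or_pos with rfl | hn
  · simp
  have hn' : (1 : ℝ≥0) ≤ n := by exact_mod_cast hn
  have hn0 : (n : ℝ≥0) ≠ 0 := by positivity
  have h := φ.convexOn.2 (mem_univ ((n : ℝ≥0) * t)) (mem_univ 0)
    (zero_le (a := (n : ℝ≥0)⁻¹)) (zero_le (a := 1 - (n : ℝ≥0)⁻¹))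
    (add_tsub_cancel_of_le (inv_le_one_of_one_le₀ hn'))
  simp only [smul_eq_mul, mul_zero, add_zero, φ.map_zero, inv_mul_cancel_left₀ hn0] at h
  calc (n : ℝ≥0) * φ t ≤ n * ((n : ℝ≥0)⁻¹ * φ (n * t)) := by gcongr
    _ = φ (n * t) := by rw [mul_inv_cancel_left₀ hn0]

theorem eq_zero_of_luxNorm_eq_zero {f : L0} (h : φ.luxNorm f = 0) : f = 0 := by
  have h1 : ∀ l : ℝ≥0, 0 < l → φ.modular l f ≤ 1 := fun l hl => by
    obtain ⟨m, hm, hm1, hml⟩ := φ.luxNorm_lt_iff.1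
      (show φ.luxNorm f < (l : ℝ≥0∞) by rw [h]; exact_mod_cast hl)
    exact (φ.modular_anti f hm (by exact_mod_cast hml.le)).trans hm1
  have h2 : ∀ l : ℝ≥0, 0 < l → φ.modular l f = 0 := fun l hl => by
    have h3 : ∀ n : ℕ, 0 < n → (n : ℝ≥0∞) * φ.modular l f ≤ 1 := fun n hn => by
      refine le_trans ?_ (h1 (l / n) (by positivity))
      unfold modular
      rw [← lintegral_const_mul'' _ (φ.aemeasurable_modular l f)]
      refine lintegral_mono fun x => ?_
      have h4 := φ.natCast_mul_le n (‖f x‖₊ / l)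
      have h5 : ‖f x‖₊ / (l / n) = n * (‖f x‖₊ / l) := by field_simp
      rw [h5]
      simpa using ENNReal.coe_le_coe.2 h4
    by_contra hne
    obtain ⟨n, hn⟩ := ENNReal.exists_nat_mul_gt hne (b := 1) (by simp)
    rcases n.eq_zero_or_pos with rfl | hn0
    · simp at hn
    · exact absurd hn (not_lt.2 (h3 n hn0))
  obtain ⟨t, ht⟩ := φ.exists_pos
  have h6 : ∀ n : ℕ, ∀ᵐ x : unitInterval, φ (‖f x‖₊ / ((n : ℝ≥0) + 1)⁻¹) = 0 := fun n => by
    have := (lintegral_eq_zero_iff' (φ.aemeasurable_modular _ f)).1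
      (h2 ((n : ℝ≥0) + 1)⁻¹ (by positivity))
    filter_upwards [this] with x hx
    simpa using hx
  refine AEEqFun.ext ?_
  filter_upwards [ae_all_iff.2 h6, AEEqFun.coeFn_zero (α := unitInterval) (μ := volume) (β := ℝ)]
    with x hx h0
  rw [h0]
  by_contra hne
  have hpos : 0 < ‖f x‖₊ := by simpa using hne
  obtain ⟨n, hn⟩ := exists_nat_gt (t / ‖f x‖₊)
  have h7 : t ≤ ‖f x‖₊ / ((n : ℝ≥0) + 1)⁻¹ := by
    rw [div_inv_eq_mul, mul_comm]
    refine ((div_lt_iff₀ hpos).1 hn).le.trans ?_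
    gcongr
    simp
  exact absurd (φ.monotone h7) (by rw [hx n]; exact not_le.2 ht)

end OrliczFunction

/-- The Orlicz space `L^φ[0,1]`, with the operations and the order of `L⁰[0,1]`. -/
def OrliczSpace (φ : OrliczFunction) : Submodule ℝ L0 where
  carrier := {f | φ.luxNorm f < ⊤}
  zero_mem' := by simp [φ.luxNorm_zero]
  add_mem' {f g} hf hg := (φ.luxNorm_add f g).trans_lt (ENNReal.add_lt_top.2 ⟨hf, hg⟩)
  smul_mem' c f hf := by
    change φ.luxNorm (c • f) < ⊤
    rw [φ.luxNorm_smul]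
    exact ENNReal.mul_lt_top (by simp) hf

namespace OrliczSpace

variable {φ : OrliczFunction}

theorem luxNorm_ne_top (f : OrliczSpace φ) : φ.luxNorm (f : L0) ≠ ⊤ := f.2.ne

/-- The Luxemburg norm on `L^φ`. -/
instance : NormedAddCommGroup (OrliczSpace φ) :=
  AddGroupNorm.toNormedAddCommGroup
    { toFun := fun f => (φ.luxNorm (f : L0)).toReal
      map_zero' := by simp [φ.luxNorm_zero]
      add_le' := fun f g => by
        rw [← ENNReal.toReal_add (luxNorm_ne_top f) (luxNorm_ne_top g)]
        exact ENNReal.toReal_mono (ENNReal.add_ne_top.2 ⟨luxNorm_ne_top f, luxNorm_ne_top g⟩)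
          (φ.luxNorm_add f g)
      neg' := fun f => by
        have h := φ.luxNorm_smul (-1) (f : L0)
        simp only [neg_smul, one_smul, nnnorm_neg, nnnorm_one, ENNReal.coe_one, one_mul] at h
        simp [h]
      eq_zero_of_map_eq_zero' := fun f hf => by
        rcases (ENNReal.toReal_eq_zero_iff _).1 hf with h | h
        · exact Subtype.ext (φ.eq_zero_of_luxNorm_eq_zero h)
        · exact absurd h (luxNorm_ne_top f) }

theorem norm_def (f : OrliczSpace φ) : ‖f‖ = (φ.luxNorm (f : L0)).toReal := rfl

instance : NormedSpace ℝ (OrliczSpace φ) where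
  norm_smul_le c f := by
    rw [norm_def, norm_def]
    simp [φ.luxNorm_smul]

theorem abs_mem {f : L0} (hf : f ∈ OrliczSpace φ) : |f| ∈ OrliczSpace φ := by
  refine (φ.luxNorm_mono ?_).trans_lt hf
  filter_upwards [AEEqFun.coeFn_abs f] with x hx
  rw [hx]; simp

theorem sup_mem {f g : L0} (hf : f ∈ OrliczSpace φ) (hg : g ∈ OrliczSpace φ) :
    f ⊔ g ∈ OrliczSpace φ := by
  have h := (OrliczSpace φ).add_mem (abs_mem hf) (abs_mem hg)
  refine (φ.luxNorm_mono ?_).trans_lt h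
  filter_upwards [AEEqFun.coeFn_sup f g, AEEqFun.coeFn_add |f| |g|, AEEqFun.coeFn_abs f,
    AEEqFun.coeFn_abs g] with x h1 h2 h3 h4
  rw [h1, h2, Pi.add_apply, h3, h4]
  rw [← NNReal.coe_le_coe, coe_nnnorm, coe_nnnorm, Real.norm_eq_abs, Real.norm_eq_abs,
    abs_of_nonneg (add_nonneg (abs_nonneg (f x)) (abs_nonneg (g x)))]
  exact abs_max_le_max_abs_abs.trans (max_le_add_of_nonneg (abs_nonneg _) (abs_nonneg _))

theorem inf_mem {f g : L0} (hf : f ∈ OrliczSpace φ) (hg : g ∈ OrliczSpace φ) :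
    f ⊓ g ∈ OrliczSpace φ := by
  have h := (OrliczSpace φ).add_mem (abs_mem hf) (abs_mem hg)
  refine (φ.luxNorm_mono ?_).trans_lt h
  filter_upwards [AEEqFun.coeFn_inf f g, AEEqFun.coeFn_add |f| |g|, AEEqFun.coeFn_abs f,
    AEEqFun.coeFn_abs g] with x h1 h2 h3 h4
  rw [h1, h2, Pi.add_apply, h3, h4]
  rw [← NNReal.coe_le_coe, coe_nnnorm, coe_nnnorm, Real.norm_eq_abs, Real.norm_eq_abs,
    abs_of_nonneg (add_nonneg (abs_nonneg (f x)) (abs_nonneg (g x)))]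
  exact abs_min_le_max_abs_abs.trans (max_le_add_of_nonneg (abs_nonneg _) (abs_nonneg _))

/-- The lattice operations of `L^φ` are those of `L⁰`, that is, pointwise almost everywhere. -/
instance : Lattice (OrliczSpace φ) :=
  Subtype.lattice (fun _ _ hf hg => sup_mem hf hg) (fun _ _ hf hg => inf_mem hf hg)

theorem coe_abs (f : OrliczSpace φ) : ((|f| : OrliczSpace φ) : L0) = |(f : L0)| := rfl

instance : IsOrderedAddMonoid (OrliczSpace φ) where
  add_le_add_left f g h k := by
    change (f : L0) + k ≤ (g : L0) + k
    have h' : (f : L0) ≤ (g : L0) := h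
    rw [← AEEqFun.coeFn_le] at h' ⊢
    filter_upwards [h', AEEqFun.coeFn_add (f : L0) (k : L0), AEEqFun.coeFn_add (g : L0) (k : L0)]
      with x h1 h2 h3
    rw [h2, h3]
    simpa using h1

instance : HasSolidNorm (OrliczSpace φ) where
  solid f g h := by
    refine ENNReal.toReal_mono (luxNorm_ne_top g) (φ.luxNorm_mono ?_)
    have h' : |(f : L0)| ≤ |(g : L0)| := h
    filter_upwards [AEEqFun.coeFn_le.2 h', AEEqFun.coeFn_abs (f : L0),
      AEEqFun.coeFn_abs (g : L0)] with x h1 h2 h3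
    rw [h2, h3] at h1
    exact h1

end OrliczSpace

/-- The Orlicz heart `H^φ`, a subspace of `L^φ` with the norm of `L^φ`. -/
def OrliczHeart (φ : OrliczFunction) : Submodule ℝ (OrliczSpace φ) where
  carrier := {f | ∀ l : ℝ≥0, 0 < l → φ.modular l (f : L0) < ⊤}
  zero_mem' := fun l _ => by simp [φ.modular_zero]
  add_mem' {f g} hf hg l hl := by
    have h := φ.modular_add (f := (f : L0)) (g := (g : L0)) (half_pos hl) (half_pos hl)
    rw [add_halves] at h
    refine h.trans_lt (ENNReal.add_lt_top.2 ⟨?_, ?_⟩)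
    · exact ENNReal.mul_lt_top ENNReal.coe_lt_top (hf _ (half_pos hl))
    · exact ENNReal.mul_lt_top ENNReal.coe_lt_top (hg _ (half_pos hl))
  smul_mem' c f hf l hl := by
    rcases eq_or_ne c 0 with rfl | hc
    · simp [φ.modular_zero]
    have hc' : ‖c‖₊ ≠ 0 := by simpa using hc
    have h := φ.modular_smul c hc (f : L0) (l / ‖c‖₊)
    rw [mul_div_cancel₀ _ hc'] at h
    exact h.trans_lt (hf _ (by positivity))

/-- Property `(H)`: every weakly null sequence in `H^φ` has a subsequence whose Cesàro sequence
is order bounded in `L^φ`. -/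
def OrliczFunction.HasPropertyH (φ : OrliczFunction) : Prop :=
  ∀ f : ℕ → OrliczHeart φ, SigmaNull (normDual (OrliczHeart φ)) f →
    ∃ k : ℕ → ℕ, StrictMono k ∧
      OrderBounded (cesaroMeans (fun n => (f (k n) : OrliczSpace φ)))

end

/-!
All five statements are equivalent because property `(H)` already forces `φ` to satisfy the growth
condition `∇₂`, namely `2 L φ(t) ≤ φ(L t)` for some `L ≥ 1` and all large `t`
(`OrliczFunction.Nabla2`), and because under `∇₂` property `(H)` implies `oBSP`. The implications
from `oBSP` down to `(H)` are soft: a functional continuous for bounded `uo`-convergence is order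
continuous, an order continuous functional is norm continuous, and order convergent sequences are
order bounded.

*Property `(H)` implies `∇₂`* (`OrliczFunction.HasPropertyH.nabla2`). If `∇₂` fails, then `φ` grows
almost linearly on long intervals `[t, L t]`, and one can concentrate a probability law on the right
end points of these intervals so that it has all its `φ`-moments finite. A centred independent
identically distributed sequence with this law lies in the heart and is weakly null, since by the
strong law its truncations have norm null averages (`exists_sigmaNull_of_iIndepFun`). If the
averages of a subsequence were order bounded, the function `sup_m |x_m| / (m + 1)` would be in
`L^φ`. Pairwise independence bounds its modular from below by a sum over `m`
(`sum_le_lintegral_of_pairwise_indep`), and the almost linear growth makes that sum a large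
harmonic sum.

*Under `∇₂`, property `(H)` implies `oBSP`* (`OrliczFunction.HasPropertyH.hasOBSP`). By
`Nabla2.exists_rpow_le`, `φ` dominates a power with exponent `p > 1`, so bounded sequences in `L^φ`
are bounded in `L^p`. Such sequences have a subsequence all of whose further subsequences have
averages that converge almost everywhere to one limit `w`
(`exists_subseq_forall_subseq_tendsto_average`); this case of Komlós' theorem is obtained by
truncation at integer heights, which brings the sequence into the Hilbert space `L²`, and a choice
of almost orthogonal terms. Cutting off the large values of `f_n`, at the cost of an order bounded
error, and subtracting truncations of `w` gives a bounded sequence in the heart, the averages of all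
of whose subsequences tend to zero almost everywhere. It is weakly null
(`OrliczHeart.sigmaNull_of_forall_subseq_cesaroMeans`): under `∇₂`, a bounded sequence in the heart
tending to zero almost everywhere is weakly null, because it has almost disjoint subsequences, and
sums of many almost disjoint functions of norm one have norm much smaller than their number
(`norm_sum_le_of_norm_inf_le`). Property `(H)` then bounds the averages of a subsequence, and in
`L^φ` order boundedness together with almost everywhere convergence is order convergence
(`orderConverges_of_tendsto_ae`).
-/

/-! ### Orlicz functions and the Luxemburg norm -/

namespace OrliczFunction

variable (φ : OrliczFunction)

theorem map_mul_le {c : ℝ≥0} (hc : c ≤ 1) (t : ℝ≥0) : φ (c * t) ≤ c * φ t := by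
  have h := φ.convexOn.2 (mem_univ t) (mem_univ 0) (zero_le (a := c)) (zero_le (a := 1 - c))
    (add_tsub_cancel_of_le hc)
  simpa [φ.map_zero] using h

theorem map_div_le {d : ℝ≥0} (hd : 1 ≤ d) (t : ℝ≥0) : φ (t / d) ≤ φ t / d := by
  have h := φ.map_mul_le (c := d⁻¹) (inv_le_one_of_one_le₀ hd) t
  rwa [div_eq_inv_mul, div_eq_inv_mul]

/-- The quotient `φ t / t` is increasing. -/
theorem mul_map_le_mul_map {s t : ℝ≥0} (hst : s ≤ t) : t * φ s ≤ s * φ t := by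
  rcases eq_or_ne t 0 with rfl | ht
  · simp [nonpos_iff_eq_zero.1 hst, φ.map_zero]
  have h := φ.map_mul_le (c := s / t) (div_le_one_of_le₀ hst zero_le) t
  rw [div_mul_cancel₀ _ ht] at h
  calc t * φ s ≤ t * (s / t * φ t) := by gcongr
    _ = s * φ t := by field_simp

theorem exists_le_add_mul : ∃ a b : ℝ≥0, ∀ t, t ≤ a + b * φ t := by
  obtain ⟨t, ht⟩ := φ.exists_pos
  refine ⟨t, t / φ t, fun s => ?_⟩
  rcases le_total s t with h | h
  · exact h.trans le_self_add
  · have := φ.mul_map_le_mul_map h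
    calc s = s * φ t / φ t := by field_simp
      _ ≤ t * φ s / φ t := by gcongr
      _ = t / φ t * φ s := by ring
      _ ≤ _ := le_add_self

theorem tendsto_atTop : Tendsto (φ : ℝ≥0 → ℝ≥0) atTop atTop := by
  obtain ⟨t, ht⟩ := φ.exists_pos
  refine tendsto_atTop_atTop.2 fun b => ⟨max t (t * b / φ t), fun s hs => ?_⟩
  have h := φ.mul_map_le_mul_map ((le_max_left _ _).trans hs)
  have ht0 : 0 < t := pos_iff_ne_zero.2 fun h0 => by simp [h0, φ.map_zero] at ht
  have h2 : t * b ≤ s * φ t := (div_le_iff₀ ht).1 ((le_max_right _ _).trans hs)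
  exact le_of_mul_le_mul_left (h2.trans h) ht0

theorem tendsto_map_nhds_zero {ι : Type*} {l : Filter ι} {u : ι → ℝ≥0} (hu : Tendsto u l (𝓝 0)) :
    Tendsto (fun i => φ (u i)) l (𝓝 0) := by
  have h1 : Tendsto (fun i => u i * φ 1) l (𝓝 0) := by simpa using hu.mul_const (φ 1)
  refine tendsto_of_tendsto_of_tendsto_of_le_of_le' tendsto_const_nhds h1
    (Eventually.of_forall fun _ => zero_le) ?_
  filter_upwards [hu.eventually (gt_mem_nhds (zero_lt_one))] with i hi
  simpa using φ.map_mul_le hi.le 1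

theorem modular_le_one_of_luxNorm_lt {f : L0} {l : ℝ≥0} (h : φ.luxNorm f < l) :
    φ.modular l f ≤ 1 := by
  obtain ⟨m, hm, hm1, hml⟩ := φ.luxNorm_lt_iff.1 h
  exact (φ.modular_anti f hm (by exact_mod_cast hml.le)).trans hm1

/-- Enlarging the scale by a factor `d ≥ 1` divides the modular by at least `d`. -/
theorem modular_mul_le {d : ℝ≥0} (hd : 1 ≤ d) (l : ℝ≥0) (f : L0) :
    φ.modular (l * d) f ≤ (d : ℝ≥0∞)⁻¹ * φ.modular l f := by
  unfold modular
  rw [← lintegral_const_mul'' _ (φ.aemeasurable_modular l f)]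
  refine lintegral_mono fun x => ?_
  have h := φ.map_div_le hd (‖f x‖₊ / l)
  rw [div_div] at h
  rw [← ENNReal.coe_inv (by positivity : d ≠ 0), ← ENNReal.coe_mul]
  refine ENNReal.coe_le_coe.2 (h.trans (by rw [div_eq_inv_mul]))

theorem luxNorm_le_mul {f : L0} {l d : ℝ≥0} (hl : 0 < l) (hd : 1 ≤ d)
    (h : φ.modular l f ≤ d) : φ.luxNorm f ≤ (l * d : ℝ≥0) := by
  refine φ.luxNorm_le (by positivity) ((φ.modular_mul_le hd l f).trans ?_)
  calc (d : ℝ≥0∞)⁻¹ * φ.modular l f ≤ (d : ℝ≥0∞)⁻¹ * d := by gcongr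
    _ = 1 := ENNReal.inv_mul_cancel (by positivity) ENNReal.coe_ne_top

theorem luxNorm_lt_top_of_modular {f : L0} {l : ℝ≥0} (hl : 0 < l) (h : φ.modular l f < ⊤) :
    φ.luxNorm f < ⊤ := by
  refine (φ.luxNorm_le_mul (d := max 1 (φ.modular l f).toNNReal) hl (le_max_left _ _) ?_).trans_lt
    ENNReal.coe_lt_top
  rw [ENNReal.coe_max, ENNReal.coe_toNNReal h.ne]
  exact le_max_right _ _

theorem modular_mk (g : unitInterval → ℝ) (hg : AEStronglyMeasurable g volume) (l : ℝ≥0) :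
    φ.modular l (AEEqFun.mk g hg) = ∫⁻ x, (φ (‖g x‖₊ / l) : ℝ≥0∞) := by
  refine lintegral_congr_ae ?_
  filter_upwards [AEEqFun.coeFn_mk g hg] with x hx
  rw [hx]

end OrliczFunction

namespace OrliczSpace

variable {φ : OrliczFunction}

theorem le_iff_ae {f g : OrliczSpace φ} : f ≤ g ↔ ∀ᵐ x, (f : L0) x ≤ (g : L0) x :=
  AEEqFun.coeFn_le.symm

theorem coeFn_zero' : ((0 : OrliczSpace φ) : L0) =ᵐ[volume] fun _ => (0 : ℝ) :=
  AEEqFun.coeFn_zero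

theorem coeFn_abs' (f : OrliczSpace φ) :
    ((|f| : OrliczSpace φ) : L0) =ᵐ[volume] fun x => |(f : L0) x| :=
  AEEqFun.coeFn_abs (f : L0)

theorem coeFn_sub' (f g : OrliczSpace φ) :
    ((f - g : OrliczSpace φ) : L0) =ᵐ[volume] fun x => (f : L0) x - (g : L0) x :=
  AEEqFun.coeFn_sub (f : L0) (g : L0)

theorem coeFn_add' (f g : OrliczSpace φ) :
    ((f + g : OrliczSpace φ) : L0) =ᵐ[volume] fun x => (f : L0) x + (g : L0) x :=
  AEEqFun.coeFn_add (f : L0) (g : L0)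

theorem coeFn_smul' (c : ℝ) (f : OrliczSpace φ) :
    ((c • f : OrliczSpace φ) : L0) =ᵐ[volume] fun x => c * (f : L0) x :=
  AEEqFun.coeFn_smul c (f : L0)

theorem coeFn_sum' {ι : Type*} (s : Finset ι) (f : ι → OrliczSpace φ) :
    ((∑ i ∈ s, f i : OrliczSpace φ) : L0) =ᵐ[volume] fun x => ∑ i ∈ s, (f i : L0) x := by
  classical
  induction s using Finset.induction_on with
  | empty => simpa using coeFn_zero' (φ := φ)
  | insert a s ha ih =>
    rw [Finset.sum_insert ha]
    filter_upwards [coeFn_add' (f a) (∑ i ∈ s, f i), ih] with x h1 h2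
    rw [h1, h2, Finset.sum_insert ha]

theorem coeFn_cesaroMeans (f : ℕ → OrliczSpace φ) (m : ℕ) :
    ((cesaroMeans f m : OrliczSpace φ) : L0) =ᵐ[volume]
      cesaroMeans (fun n => ((f n : L0) : unitInterval → ℝ)) m := by
  filter_upwards [coeFn_smul' ((m : ℝ) + 1)⁻¹ (∑ n ∈ Finset.range (m + 1), f n),
    coeFn_sum' (Finset.range (m + 1)) f] with x h1 h2
  unfold cesaroMeans
  rw [h1, h2]
  simp

theorem abs_le_iff_ae {f g : OrliczSpace φ} : |f| ≤ g ↔ ∀ᵐ x, |(f : L0) x| ≤ (g : L0) x := by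
  rw [le_iff_ae]
  exact eventually_congr (by filter_upwards [coeFn_abs' f] with x hx; rw [hx])

theorem nonneg_iff_ae {f : OrliczSpace φ} : 0 ≤ f ↔ ∀ᵐ x, 0 ≤ (f : L0) x := by
  rw [le_iff_ae]
  exact eventually_congr (by filter_upwards [coeFn_zero' (φ := φ)] with x hx; rw [hx])

/-- The element of `L^φ` given by a measurable function of finite modular at some scale. -/
noncomputable def ofFun (g : unitInterval → ℝ) (hg : AEStronglyMeasurable g volume)
    (h : ∃ l : ℝ≥0, 0 < l ∧ ∫⁻ x, (φ (‖g x‖₊ / l) : ℝ≥0∞) < ⊤) : OrliczSpace φ :=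
  ⟨AEEqFun.mk g hg, by
    obtain ⟨l, hl, hl'⟩ := h
    exact φ.luxNorm_lt_top_of_modular hl (by rwa [φ.modular_mk])⟩

theorem coeFn_ofFun {g : unitInterval → ℝ} {hg : AEStronglyMeasurable g volume}
    {h : ∃ l : ℝ≥0, 0 < l ∧ ∫⁻ x, (φ (‖g x‖₊ / l) : ℝ≥0∞) < ⊤} :
    ((ofFun g hg h : OrliczSpace φ) : L0) =ᵐ[volume] g := AEEqFun.coeFn_mk g hg

theorem modular_ofFun {g : unitInterval → ℝ} {hg : AEStronglyMeasurable g volume}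
    {h : ∃ l : ℝ≥0, 0 < l ∧ ∫⁻ x, (φ (‖g x‖₊ / l) : ℝ≥0∞) < ⊤} (l : ℝ≥0) :
    φ.modular l (ofFun g hg h : OrliczSpace φ) = ∫⁻ x, (φ (‖g x‖₊ / l) : ℝ≥0∞) :=
  φ.modular_mk g hg l

theorem modular_le_one {f : OrliczSpace φ} {l : ℝ≥0} (h : ‖f‖ < l) :
    φ.modular l (f : L0) ≤ 1 := by
  refine φ.modular_le_one_of_luxNorm_lt ?_
  rw [norm_def] at h
  rw [← ENNReal.ofReal_toReal (luxNorm_ne_top f), ← ENNReal.ofReal_coe_nnreal]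
  exact (ENNReal.ofReal_lt_ofReal_iff_of_nonneg ENNReal.toReal_nonneg).2 h

theorem norm_le_of_modular_le_one {f : OrliczSpace φ} {l : ℝ≥0} (hl : 0 < l)
    (h : φ.modular l (f : L0) ≤ 1) : ‖f‖ ≤ l := by
  simpa [norm_def] using ENNReal.toReal_mono ENNReal.coe_ne_top (φ.luxNorm_le hl h)

theorem norm_le_mul_of_modular_le {f : OrliczSpace φ} {l d : ℝ≥0} (hl : 0 < l) (hd : 1 ≤ d)
    (h : φ.modular l (f : L0) ≤ d) : ‖f‖ ≤ l * d := by
  simpa [norm_def] using ENNReal.toReal_mono ENNReal.coe_ne_top (φ.luxNorm_le_mul hl hd h)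

theorem norm_le_norm_of_ae {f g : OrliczSpace φ} (h : ∀ᵐ x, |(f : L0) x| ≤ |(g : L0) x|) :
    ‖f‖ ≤ ‖g‖ := by
  refine norm_le_norm_of_abs_le_abs (abs_le_iff_ae.2 ?_)
  filter_upwards [h, coeFn_abs' g] with x h1 h2
  rwa [h2]

/-- A sequence whose modulars at a common scale are dominated by one integrable function is
dominated by an element of `L^φ`: its pointwise supremum. -/
theorem exists_forall_abs_le {v : ℕ → unitInterval → ℝ} (hv : ∀ n, AEMeasurable (v n) volume)
    {l : ℝ≥0} (hl : 0 < l) {S : unitInterval → ℝ≥0∞} (hS : AEMeasurable S volume)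
    (hS' : ∫⁻ x, S x ≠ ⊤)
    (h : ∀ n, ∀ᵐ x, (φ (‖v n x‖₊ / l) : ℝ≥0∞) ≤ S x) :
    ∃ R : OrliczSpace φ, 0 ≤ R ∧ ∀ᵐ x, ∀ n, |v n x| ≤ (R : L0) x := by
  obtain ⟨a, b, hab⟩ := φ.exists_le_add_mul
  set B : unitInterval → ℝ≥0∞ := fun x => ⨆ n, (‖v n x‖₊ : ℝ≥0∞) with hB
  have hBm : AEMeasurable B volume :=
    AEMeasurable.iSup fun n => measurable_coe_nnreal_ennreal.comp_aemeasurable (hv n).nnnorm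
  have hfin : ∀ᵐ x, S x < ⊤ := ae_lt_top' hS hS'
  have h' : ∀ᵐ x, ∀ n, (φ (‖v n x‖₊ / l) : ℝ≥0∞) ≤ S x := ae_all_iff.2 h
  have hBfin : ∀ᵐ x, B x < ⊤ := by
    filter_upwards [hfin, h'] with x h1 h2
    refine lt_of_le_of_lt (iSup_le fun n => ?_)
      (show (l : ℝ≥0∞) * (a + b * S x) < ⊤ from ENNReal.mul_lt_top ENNReal.coe_lt_top
        (ENNReal.add_lt_top.2 ⟨ENNReal.coe_lt_top, ENNReal.mul_lt_top ENNReal.coe_lt_top h1⟩))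
    have h3 : ‖v n x‖₊ ≤ l * (a + b * φ (‖v n x‖₊ / l)) := by
      have := hab (‖v n x‖₊ / l)
      rwa [div_le_iff₀' hl] at this
    calc (‖v n x‖₊ : ℝ≥0∞) ≤ (l * (a + b * φ (‖v n x‖₊ / l)) : ℝ≥0) := ENNReal.coe_le_coe.2 h3
      _ = l * (a + b * (φ (‖v n x‖₊ / l) : ℝ≥0∞)) := by push_cast; rfl
      _ ≤ _ := by gcongr; exact h2 n
  have hmod : ∀ᵐ x, (φ (‖(B x).toReal‖₊ / (2 * l)) : ℝ≥0∞) ≤ S x := by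
    filter_upwards [hBfin, h'] with x h1 h2
    rcases eq_or_ne (B x) 0 with h0 | h0
    · simp [h0, φ.map_zero]
    have h3 : B x / 2 < B x := ENNReal.half_lt_self h0 h1.ne
    obtain ⟨n, hn⟩ := lt_iSup_iff.1 h3
    refine le_trans (ENNReal.coe_le_coe.2 (φ.monotone ?_)) (h2 n)
    have h4 : ‖(B x).toReal‖₊ = (B x).toNNReal := by
      ext; simp [ENNReal.coe_toNNReal_eq_toReal]
    rw [h4, ← div_div]
    have : (B x).toNNReal / 2 ≤ ‖v n x‖₊ := by
      rw [← ENNReal.coe_le_coe, ENNReal.coe_div (by norm_num), ENNReal.coe_toNNReal h1.ne]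
      exact hn.le
    gcongr
  refine ⟨ofFun (fun x => (B x).toReal) hBm.ennreal_toReal.aestronglyMeasurable
    ⟨2 * l, by positivity, (lintegral_mono_ae hmod).trans_lt hS'.lt_top⟩, ?_, ?_⟩
  · rw [nonneg_iff_ae]
    filter_upwards [coeFn_ofFun (φ := φ)] with x hx
    rw [hx]
    exact ENNReal.toReal_nonneg
  · filter_upwards [coeFn_ofFun (φ := φ), hBfin] with x hx h1 n
    rw [hx]
    have h2 : (‖v n x‖₊ : ℝ≥0∞) ≤ B x := le_iSup (fun n => (‖v n x‖₊ : ℝ≥0∞)) n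
    simpa using ENNReal.toReal_mono h1.ne h2

end OrliczSpace

namespace OrliczHeart

variable {φ : OrliczFunction}

/-- Order continuity of the norm on the Orlicz heart. -/
theorem tendsto_norm_zero {Z : OrliczSpace φ} (hZ : Z ∈ OrliczHeart φ) {v : ℕ → OrliczSpace φ}
    (hv : ∀ n, ∀ᵐ x, |(v n : L0) x| ≤ |(Z : L0) x|)
    (hlim : ∀ᵐ x, Tendsto (fun n => (v n : L0) x) atTop (𝓝 0)) :
    Tendsto (fun n => ‖v n‖) atTop (𝓝 0) := by
  have key : ∀ l : ℝ≥0, 0 < l → Tendsto (fun n => φ.modular l (v n : L0)) atTop (𝓝 0) := by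
    intro l hl
    have h := tendsto_lintegral_of_dominated_convergence' (μ := volume)
      (F := fun n x => (φ (‖(v n : L0) x‖₊ / l) : ℝ≥0∞)) (f := fun _ => 0)
      (fun x => (φ (‖(Z : L0) x‖₊ / l) : ℝ≥0∞))
      (fun n => φ.aemeasurable_modular l _)
      (fun n => by
        filter_upwards [hv n] with x hx
        refine ENNReal.coe_le_coe.2 (φ.monotone ?_)
        have : ‖(v n : L0) x‖₊ ≤ ‖(Z : L0) x‖₊ := hx
        gcongr) (hZ l hl).ne
      (by
        filter_upwards [hlim] with x hx
        have h1 : Tendsto (fun n => ‖(v n : L0) x‖₊ / l) atTop (𝓝 0) := by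
          have := hx.nnnorm.div_const l
          simpa using this
        exact ENNReal.tendsto_coe.2 (φ.tendsto_map_nhds_zero h1))
    rwa [lintegral_zero] at h
  rw [Metric.tendsto_atTop]
  intro ε hε
  have hε' : 0 < (ε / 2).toNNReal := by simpa using hε
  obtain ⟨N, hN⟩ := eventually_atTop.1 ((key _ hε').eventually (gt_mem_nhds zero_lt_one))
  refine ⟨N, fun n hn => ?_⟩
  have := OrliczSpace.norm_le_of_modular_le_one hε' (hN n hn).le
  rw [Real.coe_toNNReal _ (by positivity)] at this
  rw [Real.dist_eq, sub_zero, abs_of_nonneg (norm_nonneg _)]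
  linarith

theorem mem_of_bounded {f : OrliczSpace φ} {K : ℝ≥0} (h : ∀ᵐ x, |(f : L0) x| ≤ K) :
    f ∈ OrliczHeart φ := by
  intro l hl
  calc φ.modular l (f : L0) ≤ ∫⁻ _ : unitInterval, (φ (K / l) : ℝ≥0∞) := by
        refine lintegral_mono_ae ?_
        filter_upwards [h] with x hx
        refine ENNReal.coe_le_coe.2 (φ.monotone ?_)
        have : ‖(f : L0) x‖₊ ≤ K := hx
        gcongr
    _ < ⊤ := by simp

end OrliczHeart

/-! ### Order convergence in Orlicz spaces and the three dual spaces -/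

namespace OrliczSpace

variable {φ : OrliczFunction}

/-- In `L^φ`, dominated almost everywhere convergence implies order convergence; the decreasing
net is the sequence of suprema of tails. -/
theorem orderConverges_of_tendsto_ae {y : ℕ → OrliczSpace φ} {w H : OrliczSpace φ}
    (hH : ∀ n, ∀ᵐ x, |(y n : L0) x - (w : L0) x| ≤ (H : L0) x)
    (hlim : ∀ᵐ x, Tendsto (fun n => (y n : L0) x) atTop (𝓝 ((w : L0) x))) :
    OrderConverges y w := by
  set B : ℕ → unitInterval → ℝ≥0∞ := fun m x => ⨆ j, (‖(y (m + j) : L0) x - (w : L0) x‖₊ : ℝ≥0∞)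
    with hB
  have hBm : ∀ m, AEMeasurable (B m) volume := fun m =>
    AEMeasurable.iSup fun n => measurable_coe_nnreal_ennreal.comp_aemeasurable
      ((y (m + n) : L0).measurable.sub (w : L0).measurable).nnnorm.aemeasurable
  have hH' := ae_all_iff.2 hH
  have hBH : ∀ᵐ x, ∀ m, B m x ≤ ‖(H : L0) x‖₊ := by
    filter_upwards [hH'] with x hx m
    refine iSup_le fun j => ENNReal.coe_le_coe.2 ?_
    exact (hx (m + j)).trans (le_abs_self _)
  have hmod : ∀ m, ∃ l : ℝ≥0, 0 < l ∧ ∫⁻ x, (φ (‖(B m x).toReal‖₊ / l) : ℝ≥0∞) < ⊤ := by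
    intro m
    refine ⟨‖H‖₊ + 1, by positivity, ?_⟩
    refine lt_of_le_of_lt (b := φ.modular (‖H‖₊ + 1) (H : L0)) (lintegral_mono_ae ?_)
      ((modular_le_one (by simp)).trans_lt ENNReal.one_lt_top)
    filter_upwards [hBH] with x hx
    refine ENNReal.coe_le_coe.2 (φ.monotone ?_)
    have : ‖(B m x).toReal‖₊ ≤ ‖(H : L0) x‖₊ := by
      rw [← NNReal.coe_le_coe]
      simpa using ENNReal.toReal_mono ENNReal.coe_ne_top (hx m)
    gcongr
  let h : ℕ → OrliczSpace φ := fun m =>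
    ofFun (fun x => (B m x).toReal) (hBm m).ennreal_toReal.aestronglyMeasurable (hmod m)
  have hcoe : ∀ᵐ x, ∀ m, (h m : L0) x = (B m x).toReal := ae_all_iff.2 fun m => coeFn_ofFun
  have hle : ∀ m i, m ≤ i → ∀ᵐ x, |(y i : L0) x - (w : L0) x| ≤ (h m : L0) x := by
    intro m i hmi
    filter_upwards [hcoe, hBH] with x h1 h2
    rw [h1]
    have h3 : (‖(y i : L0) x - (w : L0) x‖₊ : ℝ≥0∞) ≤ B m x := by
      have := le_iSup (fun j => (‖(y (m + j) : L0) x - (w : L0) x‖₊ : ℝ≥0∞)) (i - m)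
      rwa [Nat.add_sub_cancel' hmi] at this
    simpa using ENNReal.toReal_mono ((h2 m).trans_lt ENNReal.coe_lt_top).ne h3
  have hanti : ∀ m i, m ≤ i → h i ≤ h m := by
    intro m i hmi
    rw [le_iff_ae]
    filter_upwards [hcoe, hBH] with x h1 h2
    rw [h1, h1]
    refine ENNReal.toReal_mono ((h2 m).trans_lt ENNReal.coe_lt_top).ne (iSup_le fun j => ?_)
    have := le_iSup (fun j => (‖(y (m + j) : L0) x - (w : L0) x‖₊ : ℝ≥0∞)) (i - m + j)
    rwa [← add_assoc, Nat.add_sub_cancel' hmi] at this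
  refine ⟨Set.range h, Set.range_nonempty h, ?_, ⟨?_, ?_⟩, ?_⟩
  · rintro _ ⟨m, rfl⟩ _ ⟨n, rfl⟩
    exact ⟨h (max m n), ⟨_, rfl⟩, hanti _ _ (le_max_left _ _), hanti _ _ (le_max_right _ _)⟩
  · rintro _ ⟨m, rfl⟩
    rw [nonneg_iff_ae]
    filter_upwards [hcoe] with x hx
    rw [hx]
    exact ENNReal.toReal_nonneg
  · intro z hz
    rw [le_iff_ae]
    have hz' : ∀ᵐ x, ∀ m, (z : L0) x ≤ (h m : L0) x :=
      ae_all_iff.2 fun m => le_iff_ae.1 (hz ⟨m, rfl⟩)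
    filter_upwards [hz', hcoe, hlim, coeFn_zero' (φ := φ)] with x h1 h2 h3 h4
    rw [h4]
    refine le_of_forall_pos_le_add fun ε hε => ?_
    obtain ⟨m, hm⟩ := Metric.tendsto_atTop.1 h3 ε hε
    rw [zero_add]
    refine (h1 m).trans ?_
    rw [h2]
    refine ENNReal.toReal_le_of_le_ofReal hε.le (iSup_le fun j => ?_)
    have := (hm (m + j) (by omega)).le
    rw [Real.dist_eq] at this
    have h5 := ENNReal.ofReal_le_ofReal this
    rwa [← Real.enorm_eq_ofReal_abs] at h5
  · rintro _ ⟨m, rfl⟩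
    refine ⟨m, fun i hi => abs_le_iff_ae.2 ?_⟩
    filter_upwards [hle m i hi, coeFn_sub' (y i) w] with x h1 h2
    rwa [h2]

theorem orderBounded_of_orderConverges {y : ℕ → OrliczSpace φ} {w : OrliczSpace φ}
    (h : OrderConverges y w) : OrderBounded y := by
  obtain ⟨D, ⟨d, hd⟩, -, -, hD⟩ := h
  obtain ⟨N, hN⟩ := hD d hd
  refine ⟨|w| + |d| + ∑ i ∈ Finset.range N, |y i|, ?_, fun n => ?_⟩
  · exact add_nonneg (add_nonneg (abs_nonneg _) (abs_nonneg _))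
      (Finset.sum_nonneg fun i _ => abs_nonneg _)
  · have hs : 0 ≤ ∑ i ∈ Finset.range N, |y i| := Finset.sum_nonneg fun i _ => abs_nonneg _
    rcases lt_or_ge n N with hn | hn
    · have h1 : |y n| ≤ ∑ i ∈ Finset.range N, |y i| :=
        Finset.single_le_sum (f := fun i => |y i|) (fun i _ => abs_nonneg _)
          (Finset.mem_range.2 hn)
      exact h1.trans (le_add_of_nonneg_left (add_nonneg (abs_nonneg _) (abs_nonneg _)))
    · refine le_trans ?_ (le_add_of_nonneg_right hs)
      rw [abs_le_iff_ae]
      filter_upwards [abs_le_iff_ae.1 (hN n hn), coeFn_sub' (y n) w, coeFn_add' |w| |d|,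
        coeFn_abs' w, coeFn_abs' d] with x h1 h2 h3 h4 h5
      rw [h2] at h1
      rw [h3, h4, h5]
      have := abs_sub_abs_le_abs_sub ((y n : L0) x) ((w : L0) x)
      have := le_abs_self ((d : L0) x)
      linarith

theorem uoDual_subset_orderContinuousDual :
    uoDual (OrliczSpace φ) ⊆ orderContinuousDual (OrliczSpace φ) := by
  intro g hg ι _ _ _ f hf
  obtain ⟨D, ⟨d, hd⟩, hD1, hD2, hD3⟩ := hf
  obtain ⟨i₀, hi₀⟩ := hD3 d hd
  have : IsDirectedOrder {i // i ∈ Ici i₀} := ⟨fun a b => by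
    obtain ⟨c, hac, hbc⟩ := exists_ge_ge (a : ι) b
    exact ⟨⟨c, a.2.trans hac⟩, hac, hbc⟩⟩
  have : Nonempty {i // i ∈ Ici i₀} := ⟨⟨i₀, le_refl i₀⟩⟩
  -- the tail of the net beyond `i₀` is order bounded, hence norm bounded
  have := hg {i // i ∈ Ici i₀} (fun i => f i) ⟨‖d‖, fun i => ?_⟩ ?_
  · exact (tendsto_comp_val_Ici_atTop (f := fun i => g (f i))).1 this
  · have h := hi₀ i i.2
    rw [sub_zero] at h
    exact norm_le_norm_of_abs_le_abs (h.trans (le_abs_self d))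
  · intro k hk
    refine ⟨D, ⟨d, hd⟩, hD1, hD2, fun h hh => ?_⟩
    obtain ⟨i₁, hi₁⟩ := hD3 h hh
    obtain ⟨i₂, h02, h12⟩ := exists_ge_ge i₀ i₁
    refine ⟨⟨i₂, h02⟩, fun i hi => ?_⟩
    have h1 := hi₁ i (h12.trans hi)
    simp only [sub_zero] at h1 ⊢
    rw [abs_of_nonneg (le_inf (abs_nonneg _) hk)]
    exact inf_le_left.trans h1

theorem orderContinuousDual_subset_normDual :
    orderContinuousDual (OrliczSpace φ) ⊆ normDual (OrliczSpace φ) := by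
  intro g hg
  by_contra hcont
  -- an unbounded functional equals `1` along some sequence that tends to zero very fast in norm
  have h1 : ∀ n : ℕ, ∃ f : OrliczSpace φ, g f = 1 ∧ ‖(2 : ℝ) ^ n • f‖ < (1 / 2 : ℝ) ^ n := by
    intro n
    by_contra! hn
    refine hcont (g.mkContinuous ((4 : ℝ) ^ n) fun f => ?_).continuous
    rcases eq_or_ne (g f) 0 with h0 | h0
    · rw [h0, norm_zero]; positivity
    have h := hn ((g f)⁻¹ • f) (by simp [h0])
    rw [norm_smul, norm_smul, norm_inv, norm_pow, Real.norm_ofNat] at h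
    have h2 : 0 < ‖g f‖ := norm_pos_iff.2 h0
    rw [one_div, inv_pow, inv_le_iff_one_le_mul₀ (by positivity)] at h
    have h3 : (4 : ℝ) ^ n = 2 ^ n * 2 ^ n := by rw [← mul_pow]; norm_num
    rw [h3]
    calc ‖g f‖ = ‖g f‖ * 1 := by ring
      _ ≤ ‖g f‖ * (2 ^ n * (‖g f‖⁻¹ * ‖f‖) * 2 ^ n) := by gcongr
      _ = _ := by field_simp
  choose f hf1 hf2 using h1
  have hmod : ∀ n, φ.modular 1 ((2 : ℝ) ^ n • f n : OrliczSpace φ) ≤ ((2 : ℝ≥0∞)⁻¹) ^ n := by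
    intro n
    have h2 := modular_le_one (l := (1 / 2) ^ n) (by simpa using hf2 n)
    have h3 := φ.modular_mul_le (d := 2 ^ n) (one_le_pow₀ (by norm_num)) ((1 / 2) ^ n)
      (((2 : ℝ) ^ n • f n : OrliczSpace φ) : L0)
    rw [← mul_pow, show (1 / 2 : ℝ≥0) * 2 = 1 by norm_num, one_pow] at h3
    calc _ ≤ _ := h3
      _ ≤ ((2 ^ n : ℝ≥0) : ℝ≥0∞)⁻¹ * 1 := by gcongr
      _ = _ := by rw [mul_one]; push_cast; rw [ENNReal.inv_pow]
  obtain ⟨R, hR0, hR⟩ := exists_forall_abs_le (φ := φ) (l := 1)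
    (v := fun n x => (((2 : ℝ) ^ n • f n : OrliczSpace φ) : L0) x)
    (fun n => (AEEqFun.measurable _).aemeasurable) one_pos
    (S := fun x => ∑' n, (φ (‖(((2 : ℝ) ^ n • f n : OrliczSpace φ) : L0) x‖₊ / 1) : ℝ≥0∞))
    (AEMeasurable.tsum fun n => φ.aemeasurable_modular 1 _)
    (by
      rw [lintegral_tsum fun n => φ.aemeasurable_modular 1 _]
      refine ((ENNReal.tsum_le_tsum hmod).trans_lt ?_).ne
      rw [ENNReal.tsum_geometric, ENNReal.one_sub_inv_two]
      simp)
    (fun n => ae_of_all _ fun x => ENNReal.le_tsum n)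
  have hnull : OrderConverges f 0 := by
    refine orderConverges_of_tendsto_ae (H := R) (fun n => ?_) ?_
    · filter_upwards [hR, coeFn_smul' ((2 : ℝ) ^ n) (f n), coeFn_zero' (φ := φ)] with x h1 h2 h3
      have h4 := h1 n
      simp only [h2, abs_mul] at h4
      rw [h3, sub_zero]
      refine le_trans (le_mul_of_one_le_left (abs_nonneg _) ?_) h4
      rw [abs_of_pos (by positivity)]
      exact one_le_pow₀ (by norm_num)
    · have h5 : ∀ᵐ x, ∀ n, (((2 : ℝ) ^ n • f n : OrliczSpace φ) : L0) x = 2 ^ n * (f n : L0) x :=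
        ae_all_iff.2 fun n => coeFn_smul' ((2 : ℝ) ^ n) (f n)
      filter_upwards [hR, h5, coeFn_zero' (φ := φ)] with x h1 h2 h3
      rw [h3]
      refine squeeze_zero_norm (a := fun n => (1 / 2 : ℝ) ^ n * (R : L0) x) (fun n => ?_) ?_
      · have h4 := h1 n
        simp only [h2, abs_mul] at h4
        rw [abs_of_pos (by positivity : (0 : ℝ) < 2 ^ n)] at h4
        rw [Real.norm_eq_abs, one_div, inv_pow, inv_mul_eq_div, le_div_iff₀ (by positivity)]
        linarith
      · simpa using (tendsto_pow_atTop_nhds_zero_of_lt_one (r := (1 / 2 : ℝ))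
          (by norm_num) (by norm_num)).mul_const ((R : L0) x)
  have := hg ℕ f hnull
  simp only [hf1] at this
  exact one_ne_zero (tendsto_nhds_unique tendsto_const_nhds this)

end OrliczSpace

theorem HasSigmaOBSP.mono {X : Type*} [NormedAddCommGroup X] [NormedSpace ℝ X] [Lattice X]
    {I J : Set (X →ₗ[ℝ] ℝ)} (hIJ : I ⊆ J) (h : HasSigmaOBSP I) : HasSigmaOBSP J :=
  fun f hf hJ => h f hf fun g hg => hJ g (hIJ hg)

/-- Weakly null sequences are norm bounded, by the uniform boundedness principle in the dual. -/
theorem SigmaNull.normBounded {X : Type*} [NormedAddCommGroup X] [NormedSpace ℝ X] {f : ℕ → X}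
    (hf : SigmaNull (normDual X) f) : NormBounded f := by
  have h1 : ∀ g : StrongDual ℝ X,
      ∃ C, ∀ n, ‖NormedSpace.inclusionInDoubleDual ℝ X (f n) g‖ ≤ C := by
    intro g
    have h := (hf (g : X →ₗ[ℝ] ℝ) g.continuous).norm
    obtain ⟨C, hC⟩ := h.bddAbove_range
    exact ⟨C, fun n => hC ⟨n, rfl⟩⟩
  obtain ⟨C, hC⟩ := banach_steinhaus h1
  refine ⟨C, fun n => ?_⟩
  have := (NormedSpace.inclusionInDoubleDualLi ℝ (E := X)).norm_map (f n)
  rw [← this]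
  exact hC n

theorem OrliczFunction.HasPropertyH.of_hasSigmaOBSP {φ : OrliczFunction}
    (h : HasSigmaOBSP (normDual (OrliczSpace φ))) : φ.HasPropertyH := by
  intro f hf
  obtain ⟨C, hC⟩ := hf.normBounded
  obtain ⟨k, hk, w, hw⟩ := h (fun n => (f n : OrliczSpace φ)) ⟨C, hC⟩ fun g hg =>
    hf (g ∘ₗ (OrliczHeart φ).subtype) (hg.comp continuous_subtype_val)
  exact ⟨k, hk, OrliczSpace.orderBounded_of_orderConverges hw⟩

/-! ### A subsequence principle of Komlós type for sequences bounded in `L^p`, `p > 1` -/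

section Hilbert

variable {H : Type*} [NormedAddCommGroup H] [InnerProductSpace ℝ H]

/-- Bounded sequences in a Hilbert space converge weakly along every ultrafilter. -/
theorem exists_weak_limit_ultrafilter [CompleteSpace H] (𝒰 : Ultrafilter ℕ) {v : ℕ → H} {r : ℝ}
    (hv : ∀ j, ‖v j‖ ≤ r) :
    ∃ U : H, ‖U‖ ≤ r ∧ ∀ y, Tendsto (fun j => inner ℝ (v j) y) 𝒰 (𝓝 (inner ℝ U y)) := by
  let F : ℕ → WeakDual ℝ H := fun j => StrongDual.toWeakDual (InnerProductSpace.toDual ℝ H (v j))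
  obtain ⟨ℓ, hℓ, hlim⟩ := (WeakDual.isCompact_closedBall (𝕜 := ℝ) (E := H) 0 r).ultrafilter_le_nhds'
    (𝒰.map F) (by
      refine Ultrafilter.mem_map.2 (univ_mem' fun j => ?_)
      change WeakDual.toStrongDual (F j) ∈ Metric.closedBall 0 r
      rw [mem_closedBall_zero_iff]
      change ‖InnerProductSpace.toDual ℝ H (v j)‖ ≤ r
      rw [LinearIsometryEquiv.norm_map]
      exact hv j)
  refine ⟨(InnerProductSpace.toDual ℝ H).symm (WeakDual.toStrongDual ℓ), ?_, fun y => ?_⟩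
  · rw [LinearIsometryEquiv.norm_map]
    exact mem_closedBall_zero_iff.1 hℓ
  · have h1 : Tendsto F 𝒰 (𝓝 ℓ) := hlim
    have h2 := ((WeakDual.eval_continuous y).tendsto ℓ).comp h1
    rw [InnerProductSpace.toDual_symm_apply]
    exact h2

/-- A subsequence of `v` can be chosen whose terms are almost orthogonal, simultaneously for a
whole sequence of sequences `v · b` that converge weakly to zero along an ultrafilter. -/
theorem exists_subseq_almost_orthogonal (𝒰 : Ultrafilter ℕ) (h𝒰 : (𝒰 : Filter ℕ) ≤ atTop)
    {v : ℕ → ℕ → H}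
    (hv : ∀ b y, Tendsto (fun j => inner ℝ (v j b) y) 𝒰 (𝓝 0)) :
    ∃ k : ℕ → ℕ, StrictMono k ∧ ∀ i j, i < j → ∀ a ≤ i, ∀ b ≤ j,
      |inner ℝ (v (k i) a) (v (k j) b)| ≤ (1 / 2 : ℝ) ^ j := by
  -- the pair `(q, n)` stands for the choice of the index `n` at position `q` or earlier
  obtain ⟨f, -, hf⟩ := exists_seq_of_forall_finset_exists (α := ℕ × ℕ) (fun _ => True)
    (fun p q => p.1 < q.1 ∧ p.2 < q.2 ∧ ∀ a ≤ p.1, ∀ b ≤ q.1,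
      |inner ℝ (v p.2 a) (v q.2 b)| ≤ (1 / 2 : ℝ) ^ q.1) (by
    intro s _
    set N := s.sup Prod.fst + 1
    have h1 : ∀ᶠ n in (𝒰 : Filter ℕ), ∀ p ∈ s, p.2 < n ∧ ∀ a ∈ Finset.range (p.1 + 1),
        ∀ b ∈ Finset.range (N + 1), |inner ℝ (v p.2 a) (v n b)| ≤ (1 / 2 : ℝ) ^ N := by
      rw [Filter.eventually_all_finset]
      intro p _
      have h0 : ∀ᶠ n in (𝒰 : Filter ℕ), p.2 < n := h𝒰 (eventually_gt_atTop p.2)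
      refine h0.and ?_
      rw [Filter.eventually_all_finset]
      intro a _
      rw [Filter.eventually_all_finset]
      intro b _
      have h2 := (hv b (v p.2 a)).abs
      rw [abs_zero] at h2
      filter_upwards [h2.eventually (gt_mem_nhds (show (0 : ℝ) < (1 / 2) ^ N by positivity))]
        with n hn
      rw [real_inner_comm]
      exact hn.le
    obtain ⟨n, hn⟩ := h1.exists
    refine ⟨(N, n), trivial, fun p hp => ⟨?_, (hn p hp).1, fun a ha b hb => ?_⟩⟩
    · exact Nat.lt_succ_of_le (Finset.le_sup (f := Prod.fst) hp)
    · exact (hn p hp).2 a (Finset.mem_range.2 (Nat.lt_succ_of_le ha)) b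
        (Finset.mem_range.2 (Nat.lt_succ_of_le hb)))
  have hmono : StrictMono fun n => (f n).1 := strictMono_nat_of_lt_succ fun n =>
    (hf n (n + 1) n.lt_succ_self).1
  refine ⟨fun n => (f n).2, strictMono_nat_of_lt_succ fun n => (hf n (n + 1) n.lt_succ_self).2.1,
    fun i j hij a ha b hb => ?_⟩
  refine ((hf i j hij).2.2 a (ha.trans (hmono.id_le i)) b (hb.trans (hmono.id_le j))).trans ?_
  exact pow_le_pow_of_le_one (by norm_num) (by norm_num) (hmono.id_le j)

theorem norm_sum_sq_le_of_almost_orthogonal {y : ℕ → H}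
    (hy : ∀ i j, i < j → |inner ℝ (y i) (y j)| ≤ (1 / 2 : ℝ) ^ j) (m : ℕ) :
    ‖∑ n ∈ Finset.range m, y n‖ ^ 2 ≤ ∑ n ∈ Finset.range m, (‖y n‖ ^ 2 + 2) := by
  induction m with
  | zero => simp
  | succ m ih =>
    rw [Finset.sum_range_succ, Finset.sum_range_succ, norm_add_sq_real]
    have h1 : |inner ℝ (∑ n ∈ Finset.range m, y n) (y m)| ≤ 1 := by
      rw [sum_inner]
      calc _ ≤ ∑ n ∈ Finset.range m, |inner ℝ (y n) (y m)| := Finset.abs_sum_le_sum_abs _ _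
        _ ≤ ∑ n ∈ Finset.range m, (1 / 2 : ℝ) ^ m :=
          Finset.sum_le_sum fun n hn => hy n m (Finset.mem_range.1 hn)
        _ = m / 2 ^ m := by simp [div_eq_mul_inv]
        _ ≤ 1 := by
          rw [div_le_one (by positivity)]
          exact_mod_cast (Nat.lt_two_pow_self (n := m)).le
    have := (abs_le.1 h1).2
    linarith

end Hilbert

section Komlos

variable {Ω : Type*} [MeasurableSpace Ω] {μ : Measure Ω}

theorem tendsto_ae_zero_of_summable_norm_sq {g : ℕ → Lp ℝ 2 μ}
    (hg : Summable fun i => ‖g i‖ ^ 2) : ∀ᵐ x ∂μ, Tendsto (fun i => g i x) atTop (𝓝 0) := by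
  have h1 : ∀ i, ∫⁻ x, ‖g i x‖ₑ ^ 2 ∂μ = ENNReal.ofReal (‖g i‖ ^ 2) := by
    intro i
    have h := eLpNorm_nnreal_pow_eq_lintegral (f := g i) (μ := μ) (p := 2) (by norm_num)
    rw [Lp.norm_def, ENNReal.ofReal_pow ENNReal.toReal_nonneg,
      ENNReal.ofReal_toReal (Lp.eLpNorm_ne_top (g i))]
    simpa using h.symm
  have h2 : ∫⁻ x, ∑' i, ‖g i x‖ₑ ^ 2 ∂μ ≠ ⊤ := by
    rw [lintegral_tsum fun i => (Lp.aestronglyMeasurable (g i)).enorm.pow_const 2]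
    simp_rw [h1]
    exact hg.tsum_ofReal_ne_top
  have h3 : AEMeasurable (fun x => ∑' i, ‖g i x‖ₑ ^ 2) μ :=
    AEMeasurable.tsum fun i => (Lp.aestronglyMeasurable (g i)).enorm.pow_const 2
  filter_upwards [ae_lt_top' h3 h2] with x hx
  have h4 := ENNReal.tendsto_atTop_zero_of_tsum_ne_top hx.ne
  have h5 : Tendsto (fun i => ‖g i x‖ ^ 2) atTop (𝓝 0) := by
    have := (ENNReal.tendsto_toReal ENNReal.zero_ne_top).comp h4
    simpa [Function.comp_def] using this
  have h6 : Tendsto (fun i => ‖g i x‖) atTop (𝓝 0) := by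
    have := h5.sqrt
    simpa [Real.sqrt_sq_eq_abs] using this
  exact tendsto_zero_iff_norm_tendsto_zero.2 h6

/-- Averages of an almost orthogonal sequence with slowly growing norms tend to zero almost
everywhere along geometrically growing indices. -/
theorem tendsto_ae_average_floor_pow {y : ℕ → Lp ℝ 2 μ} {A p : ℝ} (hp1 : 1 < p) (hp2 : p ≤ 2)
    (hyn : ∀ n, ‖y n‖ ^ 2 ≤ A * (n : ℝ) ^ (2 - p))
    (hy : ∀ i j, i < j → |inner ℝ (y i) (y j)| ≤ (1 / 2 : ℝ) ^ j) {c : ℝ} (hc : 1 < c) :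
    ∀ᵐ x ∂μ, Tendsto (fun i : ℕ => (∑ n ∈ Finset.range ⌊c ^ i⌋₊, y n x) / (⌊c ^ i⌋₊ : ℝ))
      atTop (𝓝 0) := by
  have hA : 0 ≤ A := by
    have := hyn 1
    simp only [Nat.cast_one, Real.one_rpow, mul_one] at this
    exact (sq_nonneg _).trans this
  have h1 : ∀ m : ℕ, 0 < m → ‖(m : ℝ)⁻¹ • ∑ n ∈ Finset.range m, y n‖ ^ 2 ≤
      (A + 2) * (m : ℝ) ^ (1 - p) := by
    intro m hm
    have hm1 : (1 : ℝ) ≤ m := by exact_mod_cast hm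
    have h2 := norm_sum_sq_le_of_almost_orthogonal hy m
    have h3 : ∑ n ∈ Finset.range m, (‖y n‖ ^ 2 + 2) ≤
        ∑ n ∈ Finset.range m, (A + 2) * (m : ℝ) ^ (2 - p) := by
      refine Finset.sum_le_sum fun n hn => ?_
      have h4 : (n : ℝ) ^ (2 - p) ≤ (m : ℝ) ^ (2 - p) :=
        Real.rpow_le_rpow (by positivity)
          (by exact_mod_cast (Finset.mem_range.1 hn).le) (by linarith)
      have h5 : 1 ≤ (m : ℝ) ^ (2 - p) := Real.one_le_rpow hm1 (by linarith)
      have h6 := hyn n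
      nlinarith [mul_le_mul_of_nonneg_left h4 hA]
    rw [Finset.sum_const, Finset.card_range, nsmul_eq_mul] at h3
    rw [norm_smul, mul_pow, norm_inv, Real.norm_natCast]
    have h7 : (m : ℝ) ^ (1 - p) = (m : ℝ)⁻¹ ^ 2 * (m * (m : ℝ) ^ (2 - p)) := by
      rw [show (1 : ℝ) - p = (2 - p) - 1 by ring, Real.rpow_sub_one (by positivity)]
      field_simp
    rw [h7]
    calc _ ≤ (m : ℝ)⁻¹ ^ 2 * (m * ((A + 2) * (m : ℝ) ^ (2 - p))) := by
          gcongr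
          exact h2.trans h3
      _ = _ := by ring
  have hpos : ∀ i, 0 < ⌊c ^ i⌋₊ := fun i => Nat.floor_pos.2 (one_le_pow₀ hc.le)
  have hc0 : 0 < 1 - c⁻¹ := by
    have := inv_lt_one_of_one_lt₀ hc
    linarith
  have hsum : Summable fun i : ℕ =>
      ‖((⌊c ^ i⌋₊ : ℝ)⁻¹ • ∑ n ∈ Finset.range ⌊c ^ i⌋₊, y n : Lp ℝ 2 μ)‖ ^ 2 := by
    refine Summable.of_nonneg_of_le (fun _ => sq_nonneg _)
      (f := fun i => (A + 2) * (1 - c⁻¹) ^ (1 - p) * (c ^ (1 - p)) ^ i) (fun i => ?_) ?_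
    · refine (h1 _ (hpos i)).trans ?_
      rw [mul_assoc]
      gcongr
      have h2 := mul_pow_le_nat_floor_pow hc i
      have h3 := Real.rpow_le_rpow_of_nonpos (by positivity) h2 (show 1 - p ≤ 0 by linarith)
      rw [Real.mul_rpow hc0.le (by positivity)] at h3
      refine h3.trans (le_of_eq ?_)
      congr 1
      rw [← Real.rpow_natCast, ← Real.rpow_natCast, ← Real.rpow_mul (by linarith),
        ← Real.rpow_mul (by linarith), mul_comm]
    · refine Summable.mul_left _ (summable_geometric_of_lt_one (by positivity) ?_)
      exact Real.rpow_lt_one_of_one_lt_of_neg hc (by linarith)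
  have hcoe : ∀ᵐ x ∂μ, ∀ i : ℕ,
      ((⌊c ^ i⌋₊ : ℝ)⁻¹ • ∑ n ∈ Finset.range ⌊c ^ i⌋₊, y n : Lp ℝ 2 μ) x =
        (∑ n ∈ Finset.range ⌊c ^ i⌋₊, y n x) / (⌊c ^ i⌋₊ : ℝ) := by
    refine ae_all_iff.2 fun i => ?_
    filter_upwards [Lp.coeFn_smul (⌊c ^ i⌋₊ : ℝ)⁻¹ (∑ n ∈ Finset.range ⌊c ^ i⌋₊, y n : Lp ℝ 2 μ),
      Lp.coeFn_finsetSum (Finset.range ⌊c ^ i⌋₊) y] with x h1 h2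
    rw [h1, Pi.smul_apply, h2, smul_eq_mul, div_eq_inv_mul]
    simp
  filter_upwards [tendsto_ae_zero_of_summable_norm_sq hsum, hcoe] with x h1 h2
  simpa only [h2] using h1

end Komlos

section KomlosSubsequence

variable {Ω : Type*} [MeasurableSpace Ω] {μ : Measure Ω} [IsFiniteMeasure μ]

theorem memLp_two_min {u : Ω → ℝ} (hu : Measurable u) (hu0 : ∀ x, 0 ≤ u x) (b : ℕ) :
    MemLp (fun x => min (u x) b) 2 μ :=
  MemLp.of_bound (hu.min measurable_const).aestronglyMeasurable b
    (ae_of_all _ fun x => by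
      rw [Real.norm_eq_abs, abs_of_nonneg (le_min (hu0 x) (Nat.cast_nonneg b))]
      exact min_le_right _ _)

/-- Truncating at height `b` a function bounded in `L^p` yields a slowly growing `L²` norm. -/
theorem norm_toLp_min_sq_le {u : Ω → ℝ} (hu : Measurable u) (hu0 : ∀ x, 0 ≤ u x) {p : ℝ}
    (hp1 : 1 < p) (hp2 : p ≤ 2) {C : ℝ≥0} (hC : ∫⁻ x, ENNReal.ofReal (u x ^ p) ∂μ ≤ C) (b : ℕ) :
    ‖(memLp_two_min (μ := μ) hu hu0 b).toLp‖ ^ 2 ≤ C * (b : ℝ) ^ (2 - p) := by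
  have h1 : ‖(memLp_two_min (μ := μ) hu hu0 b).toLp‖ₑ ^ 2 =
      ∫⁻ x, ‖min (u x) (b : ℝ)‖ₑ ^ 2 ∂μ := by
    rw [Lp.enorm_toLp]
    have h := eLpNorm_nnreal_pow_eq_lintegral (f := fun x => min (u x) (b : ℝ)) (μ := μ) (p := 2)
      (by norm_num)
    simpa using h
  have h2 : ∀ x, ‖min (u x) (b : ℝ)‖ₑ ^ 2 ≤
      ENNReal.ofReal ((b : ℝ) ^ (2 - p)) * ENNReal.ofReal (u x ^ p) := by
    intro x
    have hm0 : 0 ≤ min (u x) (b : ℝ) := le_min (hu0 x) (Nat.cast_nonneg b)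
    rw [Real.enorm_eq_ofReal hm0, ← ENNReal.ofReal_pow hm0, ← ENNReal.ofReal_mul (by positivity)]
    refine ENNReal.ofReal_le_ofReal ?_
    calc min (u x) (b : ℝ) ^ 2 = min (u x) (b : ℝ) ^ ((2 - p) + p) := by
          rw [sub_add_cancel]; norm_cast
      _ = min (u x) (b : ℝ) ^ (2 - p) * min (u x) (b : ℝ) ^ p :=
          Real.rpow_add_of_nonneg hm0 (by linarith) (by linarith)
      _ ≤ _ := by
          exact mul_le_mul (Real.rpow_le_rpow hm0 (min_le_right _ _) (by linarith))
            (Real.rpow_le_rpow hm0 (min_le_left _ _) (by linarith)) (by positivity) (by positivity)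
  have h3 : ‖(memLp_two_min (μ := μ) hu hu0 b).toLp‖ₑ ^ 2 ≤
      ENNReal.ofReal ((b : ℝ) ^ (2 - p)) * C := by
    rw [h1]
    calc _ ≤ ∫⁻ x, ENNReal.ofReal ((b : ℝ) ^ (2 - p)) * ENNReal.ofReal (u x ^ p) ∂μ :=
          lintegral_mono h2
      _ = ENNReal.ofReal ((b : ℝ) ^ (2 - p)) * ∫⁻ x, ENNReal.ofReal (u x ^ p) ∂μ :=
          lintegral_const_mul _ (hu.pow_const p).ennreal_ofReal
      _ ≤ _ := by gcongr
  have h4 := ENNReal.toReal_mono (ENNReal.mul_ne_top ENNReal.ofReal_ne_top ENNReal.coe_ne_top) h3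
  rw [ENNReal.toReal_pow, toReal_enorm, ENNReal.toReal_mul, ENNReal.toReal_ofReal (by positivity),
    mul_comm] at h4
  simpa using h4

/-- Weak limits of an increasing sequence of truncations of a sequence bounded in `L¹` converge
almost everywhere. -/
theorem exists_tendsto_ae_of_weak_limits {𝒰 : Ultrafilter ℕ} {u : ℕ → Ω → ℝ}
    (hu : ∀ j, Measurable (u j)) (hu0 : ∀ j x, 0 ≤ u j x) {C : ℝ}
    (hC : ∀ j (b : ℕ), ∫ x, min (u j x) b ∂μ ≤ C) {U : ℕ → Lp ℝ 2 μ}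
    (hU : ∀ b y, Tendsto (fun j => inner ℝ ((memLp_two_min (μ := μ) (hu j) (hu0 j) b).toLp) y) 𝒰
      (𝓝 (inner ℝ (U b) y))) :
    ∃ w : Ω → ℝ, Measurable w ∧ ∀ᵐ x ∂μ, Tendsto (fun b => U b x) atTop (𝓝 (w x)) := by
  have hint : ∀ (b : ℕ) (s : Set Ω), MeasurableSet s →
      Tendsto (fun j => ∫ x in s, min (u j x) b ∂μ) 𝒰 (𝓝 (∫ x in s, U b x ∂μ)) := by
    intro b s hs
    have h := hU b (indicatorConstLp 2 hs (measure_ne_top μ s) (1 : ℝ))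
    simp_rw [real_inner_comm (indicatorConstLp 2 hs (measure_ne_top μ s) (1 : ℝ))] at h
    rw [L2.inner_indicatorConstLp_one] at h
    refine h.congr fun j => ?_
    rw [L2.inner_indicatorConstLp_one]
    exact setIntegral_congr_ae hs (by
      filter_upwards [(memLp_two_min (μ := μ) (hu j) (hu0 j) b).coeFn_toLp] with x hx _ using hx)
  have hI : ∀ b, Integrable (U b) μ := fun b => (Lp.memLp (U b)).integrable one_le_two
  have hmin : ∀ j (b : ℕ), Integrable (fun x => min (u j x) (b : ℝ)) μ := fun j b =>
    (memLp_two_min (hu j) (hu0 j) b).integrable one_le_two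
  have hnn : ∀ b, 0 ≤ᵐ[μ] U b := by
    intro b
    refine ae_nonneg_of_forall_setIntegral_nonneg (hI b) fun s hs _ => ?_
    exact ge_of_tendsto (hint b s hs) (Eventually.of_forall fun j =>
      integral_nonneg fun x => le_min (hu0 j x) (Nat.cast_nonneg b))
  have hmono : ∀ b, U b ≤ᵐ[μ] U (b + 1) := by
    intro b
    refine ae_le_of_forall_setIntegral_le (hI b) (hI (b + 1)) fun s hs _ => ?_
    refine le_of_tendsto_of_tendsto' (hint b s hs) (hint (b + 1) s hs) fun j => ?_
    refine integral_mono (hmin j b).integrableOn (hmin j (b + 1)).integrableOn fun x => ?_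
    exact min_le_min_left _ (by push_cast; linarith)
  have hbound : ∀ b, ∫ x, U b x ∂μ ≤ C := by
    intro b
    have := hint b univ MeasurableSet.univ
    simp only [setIntegral_univ] at this
    exact le_of_tendsto this (Eventually.of_forall fun j => hC j b)
  have hmono' : ∀ᵐ x ∂μ, Monotone fun b => U b x := by
    filter_upwards [ae_all_iff.2 hmono] with x hx
    exact monotone_nat_of_le_succ hx
  have hlin : ∫⁻ x, ⨆ b, ENNReal.ofReal (U b x) ∂μ ≤ ENNReal.ofReal C := by
    rw [lintegral_iSup' (fun b => (Lp.aestronglyMeasurable (U b)).aemeasurable.ennreal_ofReal)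
      (by filter_upwards [hmono'] with x hx a b hab using ENNReal.ofReal_le_ofReal (hx hab))]
    refine iSup_le fun b => ?_
    rw [← ofReal_integral_eq_lintegral_ofReal (hI b) (hnn b)]
    exact ENNReal.ofReal_le_ofReal (hbound b)
  have hfin : ∀ᵐ x ∂μ, ⨆ b, ENNReal.ofReal (U b x) < ⊤ :=
    ae_lt_top' (AEMeasurable.iSup fun b =>
      (Lp.aestronglyMeasurable (U b)).aemeasurable.ennreal_ofReal)
      (hlin.trans_lt ENNReal.ofReal_lt_top).ne
  have hex : ∀ᵐ x ∂μ, ∃ l, Tendsto (fun b => U b x) atTop (𝓝 l) := by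
    filter_upwards [hmono', hfin, ae_all_iff.2 hnn] with x h1 h2 h3
    refine ⟨_, tendsto_atTop_ciSup h1 ⟨(⨆ b, ENNReal.ofReal (U b x)).toReal, ?_⟩⟩
    rintro _ ⟨b, rfl⟩
    have h4 := ENNReal.toReal_mono h2.ne (le_iSup (fun b => ENNReal.ofReal (U b x)) b)
    rwa [ENNReal.toReal_ofReal (h3 b)] at h4
  exact measurable_limit_of_tendsto_metrizable_ae
    (fun b => (Lp.aestronglyMeasurable (U b)).aemeasurable) hex

theorem ae_eventually_le_of_lintegral_rpow_le {u : ℕ → Ω → ℝ}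
    {p : ℝ} (hu : ∀ j, Measurable (u j))
    (hp1 : 1 < p) {C : ℝ≥0} (hC : ∀ j, ∫⁻ x, ENNReal.ofReal (u j x ^ p) ∂μ ≤ C) :
    ∀ᵐ x ∂μ, ∀ᶠ n in atTop, u n x ≤ (n : ℝ) := by
  have h1 : ∀ n : ℕ, μ {x | (n : ℝ) < u n x} ≤
      if n = 0 then μ univ else C * ENNReal.ofReal ((n : ℝ) ^ (-p)) := by
    intro n
    split_ifs with hn
    · exact measure_mono (subset_univ _)
    have hn0 : (0 : ℝ) < n := by positivity
    calc μ {x | (n : ℝ) < u n x}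
        ≤ μ {x | ENNReal.ofReal ((n : ℝ) ^ p) ≤ ENNReal.ofReal (u n x ^ p)} := by
          refine measure_mono fun x hx => ENNReal.ofReal_le_ofReal ?_
          exact Real.rpow_le_rpow hn0.le (le_of_lt hx) (by linarith)
      _ ≤ (∫⁻ x, ENNReal.ofReal (u n x ^ p) ∂μ) / ENNReal.ofReal ((n : ℝ) ^ p) :=
          meas_ge_le_lintegral_div ((hu n).pow_const p).ennreal_ofReal.aemeasurable
            (by simp; positivity) ENNReal.ofReal_ne_top
      _ ≤ C * ENNReal.ofReal ((n : ℝ) ^ (-p)) := by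
          rw [Real.rpow_neg hn0.le, ENNReal.ofReal_inv_of_pos (by positivity), div_eq_mul_inv]
          gcongr
          exact hC n
  have h2 : ∑' n : ℕ, μ {x | (n : ℝ) < u n x} ≠ ⊤ := by
    refine ne_top_of_le_ne_top ?_ (ENNReal.tsum_le_tsum h1)
    have h3 : ∀ n : ℕ, (if n = 0 then μ univ else C * ENNReal.ofReal ((n : ℝ) ^ (-p))) ≤
        (if n = 0 then μ univ else 0) + C * ENNReal.ofReal ((n : ℝ) ^ (-p)) := by
      intro n
      split_ifs <;> simp
    refine ne_top_of_le_ne_top ?_ (ENNReal.tsum_le_tsum h3)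
    rw [ENNReal.tsum_add, ENNReal.tsum_mul_left, tsum_ite_eq]
    refine ENNReal.add_ne_top.2 ⟨measure_ne_top μ univ, ENNReal.mul_ne_top ENNReal.coe_ne_top ?_⟩
    exact (Real.summable_nat_rpow.2 (by linarith)).tsum_ofReal_ne_top
  filter_upwards [ae_eventually_notMem h2] with x hx
  filter_upwards [hx] with n hn
  simpa using hn

/-- A hereditary Komlós subsequence for non-negative functions bounded in `L^p`, `1 < p ≤ 2`.
As in Etemadi's proof of the strong law, the terms are truncated at the level of their position;
the truncations, centred at their weak limits, are almost orthogonal along a subsequence, so that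
their averages converge along geometrically growing indices, and the monotonicity of the partial
sums takes care of the other indices. -/
theorem exists_subseq_forall_subseq_tendsto_average {u : ℕ → Ω → ℝ}
    (hu : ∀ j, Measurable (u j)) (hu0 : ∀ j x, 0 ≤ u j x) {p : ℝ}
    (hp1 : 1 < p) (hp2 : p ≤ 2) {C : ℝ≥0} (hC : ∀ j, ∫⁻ x, ENNReal.ofReal (u j x ^ p) ∂μ ≤ C) :
    ∃ k : ℕ → ℕ, StrictMono k ∧ ∃ w : Ω → ℝ, Measurable w ∧ ∀ l : ℕ → ℕ, StrictMono l →
      ∀ᵐ x ∂μ, Tendsto (fun m : ℕ => (∑ n ∈ Finset.range m, u (k (l n)) x) / m) atTop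
        (𝓝 (w x)) := by
  let ξ : ℕ → ℕ → Lp ℝ 2 μ := fun j b => (memLp_two_min (μ := μ) (hu j) (hu0 j) b).toLp
  have hξ : ∀ j b, ‖ξ j b‖ ^ 2 ≤ C * (b : ℝ) ^ (2 - p) := fun j b =>
    norm_toLp_min_sq_le (hu j) (hu0 j) hp1 hp2 (hC j) b
  let 𝒰 : Ultrafilter ℕ := hyperfilter ℕ
  have h𝒰 : (𝒰 : Filter ℕ) ≤ atTop := by
    rw [← Nat.cofinite_eq_atTop]
    exact hyperfilter_le_cofinite
  have hw := fun b : ℕ => exists_weak_limit_ultrafilter 𝒰 (v := fun j => ξ j b)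
    (r := √(C * (b : ℝ) ^ (2 - p))) fun j => Real.le_sqrt_of_sq_le (hξ j b)
  choose U hUn hU using hw
  have hL1 : ∀ j (b : ℕ), ∫ x, min (u j x) b ∂μ ≤ (μ univ + C).toReal := by
    intro j b
    rw [integral_eq_lintegral_of_nonneg_ae
      (ae_of_all _ fun x => le_min (hu0 j x) (Nat.cast_nonneg b))
      ((hu j).min measurable_const).aestronglyMeasurable]
    refine ENNReal.toReal_mono (by finiteness) ?_
    calc ∫⁻ x, ENNReal.ofReal (min (u j x) b) ∂μ
        ≤ ∫⁻ x, (1 + ENNReal.ofReal (u j x ^ p)) ∂μ := by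
          refine lintegral_mono fun x => ?_
          refine (ENNReal.ofReal_le_ofReal (min_le_left _ _)).trans ?_
          rw [← ENNReal.ofReal_one, ← ENNReal.ofReal_add zero_le_one (Real.rpow_nonneg (hu0 j x) _)]
          refine ENNReal.ofReal_le_ofReal ?_
          rcases le_total (u j x) 1 with h | h
          · have := Real.rpow_nonneg (hu0 j x) p
            linarith
          · have := Real.rpow_le_rpow_of_exponent_le h hp1.le
            rw [Real.rpow_one] at this
            linarith
      _ ≤ _ := by
          rw [lintegral_add_left measurable_const, lintegral_one]
          gcongr
          exact hC j
  obtain ⟨w, hwm, hwlim⟩ := exists_tendsto_ae_of_weak_limits hu hu0 hL1 hU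
  obtain ⟨k, hk, horth⟩ := exists_subseq_almost_orthogonal 𝒰 h𝒰 (v := fun j b => ξ j b - U b)
    (fun b y => by
      simp only [inner_sub_left]
      simpa using (hU b y).sub_const (inner ℝ (U b) y))
  refine ⟨k, hk, w, hwm, fun l hl => ?_⟩
  set y : ℕ → Lp ℝ 2 μ := fun n => ξ (k (l n)) n - U n with hy
  have hyn : ∀ n, ‖y n‖ ^ 2 ≤ (4 * C) * (n : ℝ) ^ (2 - p) := by
    intro n
    have h1 : ‖y n‖ ≤ 2 * √(C * (n : ℝ) ^ (2 - p)) := by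
      refine (norm_sub_le _ _).trans ?_
      have := Real.le_sqrt_of_sq_le (hξ (k (l n)) n)
      linarith [hUn n]
    calc ‖y n‖ ^ 2 ≤ (2 * √(C * (n : ℝ) ^ (2 - p))) ^ 2 := by gcongr
      _ = _ := by rw [mul_pow, Real.sq_sqrt (by positivity)]; ring
  have hyo : ∀ i j, i < j → |inner ℝ (y i) (y j)| ≤ (1 / 2 : ℝ) ^ j := fun i j hij =>
    (horth (l i) (l j) (hl hij) i (hl.id_le i) j (hl.id_le j)).trans
      (pow_le_pow_of_le_one (by norm_num) (by norm_num) (hl.id_le j))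
  let c : ℕ → ℝ := fun q => 1 + 1 / ((q : ℝ) + 1)
  have hc1 : ∀ q, 1 < c q := fun q => by
    have : (0 : ℝ) < 1 / ((q : ℝ) + 1) := by positivity
    simp only [c]; linarith
  have hclim : Tendsto c atTop (𝓝 1) := by
    have := (tendsto_one_div_add_atTop_nhds_zero_nat (𝕜 := ℝ)).const_add 1
    rwa [add_zero] at this
  have hlac := ae_all_iff.2 fun q => tendsto_ae_average_floor_pow hp1 hp2 hyn hyo (hc1 q)
  have hcoe : ∀ᵐ x ∂μ, ∀ n, y n x = min (u (k (l n)) x) n - U n x := by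
    refine ae_all_iff.2 fun n => ?_
    filter_upwards [Lp.coeFn_sub (ξ (k (l n)) n) (U n),
      (memLp_two_min (μ := μ) (hu (k (l n))) (hu0 (k (l n))) n).coeFn_toLp] with x h1 h2
    rw [h1, Pi.sub_apply, h2]
  have htail := ae_eventually_le_of_lintegral_rpow_le (u := fun n => u (k (l n)))
    (fun j => hu _) hp1 (fun j => hC _)
  filter_upwards [hlac, hcoe, hwlim, htail] with x h1 h2 h3 h4
  have h5 : Tendsto (fun m : ℕ => (∑ n ∈ Finset.range m, U n x) / m) atTop (𝓝 (w x)) := by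
    simpa only [div_eq_inv_mul] using h3.cesaro
  have h6 : Tendsto (fun m : ℕ => (∑ n ∈ Finset.range m, min (u (k (l n)) x) (n : ℝ)) / m) atTop
      (𝓝 (w x)) := by
    refine tendsto_div_of_monotone_of_tendsto_div_floor_pow
      (fun m => ∑ n ∈ Finset.range m, min (u (k (l n)) x) (n : ℝ)) (w x) ?_ c hc1 hclim fun q => ?_
    · refine monotone_nat_of_le_succ fun m => ?_
      rw [Finset.sum_range_succ]
      exact le_add_of_nonneg_right (le_min (hu0 _ x) (Nat.cast_nonneg m))
    · have h7 : Tendsto (fun i : ℕ => ⌊c q ^ i⌋₊) atTop atTop :=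
        tendsto_nat_floor_atTop.comp (tendsto_pow_atTop_atTop_of_one_lt (hc1 q))
      have h8 := (h1 q).add (h5.comp h7)
      rw [zero_add] at h8
      refine h8.congr fun i => ?_
      simp only [Function.comp_apply, h2]
      rw [← add_div, ← Finset.sum_add_distrib]
      simp
  have h9 : Tendsto (fun n : ℕ => u (k (l n)) x - min (u (k (l n)) x) (n : ℝ)) atTop (𝓝 0) := by
    refine tendsto_const_nhds.congr' ?_
    filter_upwards [h4] with n hn
    rw [min_eq_left hn, sub_self]
  have h10 := h6.add h9.cesaro
  rw [add_zero] at h10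
  refine h10.congr fun m => ?_
  rw [← div_eq_inv_mul, ← add_div, ← Finset.sum_add_distrib]
  simp

end KomlosSubsequence

/-! ### The condition `∇₂` -/

namespace OrliczFunction

variable (φ : OrliczFunction)

/-- The condition `∇₂` (for large arguments): some dilation by a factor `L` enlarges `φ` at least
by the factor `2 L`. The factor is taken to be a natural number. -/
def Nabla2 : Prop :=
  ∃ L : ℕ, 1 ≤ L ∧ ∃ t₀ : ℝ≥0, ∀ t, t₀ ≤ t → 2 * L * φ t ≤ φ (L * t)

variable {φ}

theorem pow_mul_map_le {L : ℕ} (hL : 1 ≤ L) {t₀ : ℝ≥0}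
    (h : ∀ t, t₀ ≤ t → 2 * L * φ t ≤ φ (L * t)) (r : ℕ) {t : ℝ≥0} (ht : t₀ ≤ t) :
    (2 * L) ^ r * φ t ≤ φ (L ^ r * t) := by
  induction r with
  | zero => simp
  | succ r ih =>
    have h1 : t₀ ≤ L ^ r * t := by
      refine ht.trans (le_mul_of_one_le_left zero_le (one_le_pow₀ ?_))
      exact_mod_cast hL
    calc (2 * L : ℝ≥0) ^ (r + 1) * φ t = 2 * L * ((2 * L) ^ r * φ t) := by ring
      _ ≤ 2 * L * φ (L ^ r * t) := by gcongr
      _ ≤ φ (L * (L ^ r * t)) := h _ h1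
      _ = _ := by congr 1; ring

theorem map_div_pow_le {L : ℕ} (hL : 1 ≤ L) {t₀ : ℝ≥0}
    (h : ∀ t, t₀ ≤ t → 2 * L * φ t ≤ φ (L * t)) (r : ℕ) (t : ℝ≥0) :
    φ (t / L ^ r) ≤ φ t / (2 * L) ^ r + φ t₀ := by
  rcases le_total t₀ (t / L ^ r) with ht | ht
  · have hL0 : (0 : ℝ≥0) < L := by exact_mod_cast hL
    have h1 := pow_mul_map_le hL h r ht
    rw [mul_div_cancel₀ _ (by positivity)] at h1
    refine le_trans ?_ le_self_add
    rwa [le_div_iff₀' (by positivity)]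
  · exact (φ.monotone ht).trans le_add_self

/-- Under `∇₂` the function `φ` grows at least like a power with exponent larger than one. -/
theorem Nabla2.exists_rpow_le (h : φ.Nabla2) :
    ∃ p : ℝ, 1 < p ∧ p ≤ 2 ∧ ∃ C : ℝ≥0, ∀ t : ℝ≥0, (t : ℝ) ^ p ≤ C * (1 + φ t) := by
  obtain ⟨L, hL, t₁, h⟩ := h
  obtain ⟨t₀, ht₀⟩ := (((φ.tendsto_atTop.eventually_ge_atTop 1).and
    (eventually_ge_atTop t₁)).and (eventually_ge_atTop 1)).exists
  obtain ⟨⟨hφ, ht₁⟩, ht1⟩ := ht₀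
  have h' : ∀ t, t₀ ≤ t → 2 * L * φ t ≤ φ (L * t) := fun t ht => h t (ht₁.trans ht)
  have hL2 : 2 ≤ L := by
    by_contra hcon
    have hL1 : L = 1 := by omega
    have h1 := h' t₀ le_rfl
    rw [hL1] at h1
    simp only [Nat.cast_one, mul_one, one_mul, two_mul] at h1
    have h2 : 0 < φ t₀ := zero_lt_one.trans_le hφ
    exact absurd h1 (not_le.2 (lt_add_of_pos_left _ h2))
  have hLr : (2 : ℝ) ≤ L := by exact_mod_cast hL2
  have hlog : 0 < Real.log L := Real.log_pos (by linarith)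
  have hlog2 : 0 < Real.log 2 := Real.log_pos (by norm_num)
  set p : ℝ := 1 + Real.log 2 / Real.log L with hp
  have hp1 : 1 < p := by
    have : 0 < Real.log 2 / Real.log L := by positivity
    linarith
  have hLp : (L : ℝ) ^ p = 2 * L := by
    rw [Real.rpow_def_of_pos (by linarith), hp, mul_add, mul_one, mul_div_cancel₀ _ hlog.ne',
      Real.exp_add, Real.exp_log (by linarith), Real.exp_log (by norm_num)]
    ring
  have hp2 : p ≤ 2 := by
    have : Real.log 2 / Real.log L ≤ 1 := by
      rw [div_le_one hlog]
      exact Real.log_le_log (by norm_num) hLr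
    linarith
  have ht0 : (1 : ℝ) ≤ t₀ := by exact_mod_cast ht1
  refine ⟨p, hp1, hp2, (2 * L) * t₀ ^ p, fun t => ?_⟩
  have hCt : (t₀ : ℝ) ^ p ≤ ((2 * L) * t₀ ^ p : ℝ≥0) := by
    push_cast
    exact le_mul_of_one_le_left (by positivity) (by linarith)
  rcases le_total t t₀ with ht | ht
  · calc (t : ℝ) ^ p ≤ (t₀ : ℝ) ^ p := by gcongr
      _ ≤ _ := hCt
      _ ≤ _ := le_mul_of_one_le_right NNReal.zero_le_coe (by
        have : (0 : ℝ) ≤ φ t := NNReal.zero_le_coe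
        linarith)
  · have hq : (1 : ℝ) ≤ t / t₀ := by
      rw [one_le_div (by positivity)]
      exact_mod_cast ht
    obtain ⟨r, hr1, hr2⟩ := exists_nat_pow_near hq (show (1 : ℝ) < L by linarith)
    rw [le_div_iff₀ (by positivity)] at hr1
    rw [div_lt_iff₀ (by positivity)] at hr2
    have h1 : (L : ℝ≥0) ^ r * t₀ ≤ t := by exact_mod_cast hr1
    have h2 := (pow_mul_map_le hL h' r le_rfl).trans (φ.monotone h1)
    have h3 : (2 * L : ℝ) ^ r ≤ φ t := by
      have h4 : (2 * L : ℝ≥0) ^ r ≤ φ t := (le_mul_of_one_le_right zero_le hφ).trans h2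
      exact_mod_cast h4
    calc (t : ℝ) ^ p ≤ (L ^ (r + 1) * t₀ : ℝ) ^ p := by gcongr
      _ = (2 * L : ℝ) ^ (r + 1) * (t₀ : ℝ) ^ p := by
        rw [Real.mul_rpow (by positivity) (by positivity), ← hLp, ← Real.rpow_natCast,
          ← Real.rpow_natCast, ← Real.rpow_mul (by positivity), ← Real.rpow_mul (by positivity),
          mul_comm p]
      _ = (2 * L * (t₀ : ℝ) ^ p) * (2 * L) ^ r := by ring
      _ ≤ (2 * L * (t₀ : ℝ) ^ p) * (1 + φ t) := by gcongr; linarith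
      _ = _ := by push_cast; rfl

end OrliczFunction

/-! ### Cesàro means -/

section Cesaro

variable {X : Type*} [AddCommGroup X] [Module ℝ X]

theorem map_cesaroMeans {Y : Type*} [AddCommGroup Y] [Module ℝ Y] (g : X →ₗ[ℝ] Y) (f : ℕ → X)
    (m : ℕ) : g (cesaroMeans f m) = cesaroMeans (fun n => g (f n)) m := by
  simp [cesaroMeans]

theorem cesaroMeans_add (f g : ℕ → X) (m : ℕ) :
    cesaroMeans (fun n => f n + g n) m = cesaroMeans f m + cesaroMeans g m := by
  simp [cesaroMeans, Finset.sum_add_distrib]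

theorem cesaroMeans_sub (f g : ℕ → X) (m : ℕ) :
    cesaroMeans (fun n => f n - g n) m = cesaroMeans f m - cesaroMeans g m := by
  simp [cesaroMeans, Finset.sum_sub_distrib, smul_sub]

theorem cesaroMeans_mono {f g : ℕ → ℝ} (h : ∀ n, f n ≤ g n) (m : ℕ) :
    cesaroMeans f m ≤ cesaroMeans g m := by
  unfold cesaroMeans
  gcongr
  exact h _

theorem cesaroMeans_const (c : X) (m : ℕ) : cesaroMeans (fun _ => c) m = c := by
  have : ((m : ℝ) + 1) ≠ 0 := by positivity
  rw [cesaroMeans, Finset.sum_const, Finset.card_range, ← Nat.cast_smul_eq_nsmul ℝ, smul_smul]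
  push_cast
  rw [inv_mul_cancel₀ this, one_smul]

theorem abs_cesaroMeans_le (f : ℕ → ℝ) (m : ℕ) :
    |cesaroMeans f m| ≤ cesaroMeans (fun n => |f n|) m := by
  unfold cesaroMeans
  rw [smul_eq_mul, abs_mul, abs_of_pos (by positivity), smul_eq_mul]
  gcongr
  exact Finset.abs_sum_le_sum_abs _ _

theorem norm_cesaroMeans_le {E : Type*} [NormedAddCommGroup E] [NormedSpace ℝ E] {f : ℕ → E}
    {C : ℝ} (hf : ∀ n, ‖f n‖ ≤ C) (m : ℕ) : ‖cesaroMeans f m‖ ≤ C := by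
  refine le_trans ?_ ((cesaroMeans_mono hf m).trans_eq (cesaroMeans_const C m))
  unfold cesaroMeans
  rw [norm_smul, norm_inv, smul_eq_mul, Real.norm_of_nonneg (by positivity : (0 : ℝ) ≤ m + 1)]
  gcongr
  exact norm_sum_le _ _

theorem cesaroMeans_apply {α : Type*} (f : ℕ → α → ℝ) (m : ℕ) (x : α) :
    cesaroMeans f m x = cesaroMeans (fun n => f n x) m := by
  simp [cesaroMeans]

theorem tendsto_cesaroMeans_iff {f : ℕ → ℝ} {a : ℝ} :
    Tendsto (cesaroMeans f) atTop (𝓝 a) ↔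
      Tendsto (fun m : ℕ => (∑ n ∈ Finset.range m, f n) / m) atTop (𝓝 a) := by
  rw [← tendsto_add_atTop_iff_nat 1 (f := fun m : ℕ => (∑ n ∈ Finset.range m, f n) / m)]
  refine tendsto_congr fun m => ?_
  rw [cesaroMeans, smul_eq_mul, div_eq_inv_mul]
  push_cast
  rfl

theorem tendsto_cesaroMeans_of_tendsto {f : ℕ → ℝ} {a : ℝ} (hf : Tendsto f atTop (𝓝 a)) :
    Tendsto (cesaroMeans f) atTop (𝓝 a) :=
  tendsto_cesaroMeans_iff.2 (by simpa only [div_eq_inv_mul] using hf.cesaro)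

theorem tendsto_zero_of_forall_subseq_tendsto_cesaroMeans {a : ℕ → ℝ}
    (h : ∀ k : ℕ → ℕ, StrictMono k → Tendsto (cesaroMeans (a ∘ k)) atTop (𝓝 0)) :
    Tendsto a atTop (𝓝 0) := by
  by_contra hcon
  rw [Metric.tendsto_atTop] at hcon
  push Not at hcon
  obtain ⟨ε, hε, hN⟩ := hcon
  have hfreq : ∃ᶠ n in atTop, ε ≤ a n ∨ ε ≤ - a n := by
    refine frequently_atTop.2 fun N => ?_
    obtain ⟨n, hn, h1⟩ := hN N
    rw [Real.dist_eq, sub_zero] at h1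
    exact ⟨n, hn, le_abs.1 h1⟩
  rcases frequently_or_distrib.1 hfreq with hf | hf
  · obtain ⟨k, hk, hk'⟩ := extraction_of_frequently_atTop hf
    have := ge_of_tendsto' (h k hk) fun m =>
      (cesaroMeans_const ε m).symm.trans_le (cesaroMeans_mono hk' m)
    linarith
  · obtain ⟨k, hk, hk'⟩ := extraction_of_frequently_atTop hf
    have := le_of_tendsto' (h k hk) fun m =>
      (cesaroMeans_mono (g := fun _ => -ε) (fun n => by
        have := hk' n
        simp only [Function.comp_apply]
        linarith) m).trans_eq (cesaroMeans_const (-ε) m)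
    linarith

end Cesaro

/-! ### Weakly null sequences in the Orlicz heart -/

/-- A sum is at most its largest term plus the minima of all pairs of terms. -/
theorem sum_le_of_forall_le_add_sum_min {ι : Type*} [DecidableEq ι] (s : Finset ι) {a : ι → ℝ}
    (ha : ∀ i, 0 ≤ a i) (j : ι) (hj : j ∈ s) (hmax : ∀ i ∈ s, a i ≤ a j) :
    ∑ i ∈ s, a i ≤ a j + ∑ q ∈ s.offDiag, min (a q.1) (a q.2) := by
  rw [← Finset.add_sum_erase s a hj]
  gcongr
  have h1 : ∑ i ∈ s.erase j, a i = ∑ q ∈ (s.erase j).image fun i => (i, j),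
      min (a q.1) (a q.2) := by
    rw [Finset.sum_image (fun x _ y _ h => (Prod.ext_iff.1 h).1)]
    exact Finset.sum_congr rfl fun i hi =>
      (min_eq_left (hmax i (Finset.mem_of_mem_erase hi))).symm
  rw [h1]
  refine Finset.sum_le_sum_of_subset_of_nonneg ?_ fun q _ _ => le_min (ha _) (ha _)
  intro q hq
  obtain ⟨i, hi, rfl⟩ := Finset.mem_image.1 hq
  exact Finset.mem_offDiag.2 ⟨Finset.mem_of_mem_erase hi, hj, Finset.ne_of_mem_erase hi⟩

namespace OrliczSpace

variable {φ : OrliczFunction}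

theorem coeFn_inf' (f g : OrliczSpace φ) :
    ((f ⊓ g : OrliczSpace φ) : L0) =ᵐ[volume] fun x => min ((f : L0) x) ((g : L0) x) :=
  AEEqFun.coeFn_inf (f : L0) (g : L0)

theorem coeFn_sup' (f g : OrliczSpace φ) :
    ((f ⊔ g : OrliczSpace φ) : L0) =ᵐ[volume] fun x => max ((f : L0) x) ((g : L0) x) :=
  AEEqFun.coeFn_sup (f : L0) (g : L0)

/-- The modular of a function dominated by a pointwise maximum: under `∇₂`, dilating by `L ^ r`
makes up for the number of functions being `(2 * L) ^ r`. -/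
theorem modular_le_of_forall_exists_le {s : Finset ℕ} {y : ℕ → OrliczSpace φ} {W : OrliczSpace φ}
    (hW : ∀ᵐ x, ∃ j ∈ s, |(W : L0) x| ≤ |(y j : L0) x|) {L r : ℕ} (hL : 1 ≤ L) {t₀ : ℝ≥0}
    (hφ : ∀ t, t₀ ≤ t → 2 * L * φ t ≤ φ (L * t)) {C : ℝ≥0}
    (hy : ∀ j, φ.modular C (y j : L0) ≤ 1) :
    φ.modular (C * L ^ r) (W : L0) ≤ s.card / (2 * L : ℝ≥0) ^ r + φ t₀ := by
  have hL0 : (0 : ℝ≥0) < L := by exact_mod_cast hL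
  calc φ.modular (C * L ^ r) (W : L0)
      ≤ ∫⁻ x, (((2 * L : ℝ≥0) ^ r)⁻¹ : ℝ≥0) * ∑ j ∈ s, (φ (‖(y j : L0) x‖₊ / C) : ℝ≥0∞) + φ t₀ := by
        refine lintegral_mono_ae ?_
        filter_upwards [hW] with x hx
        obtain ⟨j, hj, h1⟩ := hx
        have h2 : ‖(W : L0) x‖₊ ≤ ‖(y j : L0) x‖₊ := h1
        have h3 : φ (‖(W : L0) x‖₊ / (C * L ^ r)) ≤
            ((2 * L : ℝ≥0) ^ r)⁻¹ * ∑ j ∈ s, φ (‖(y j : L0) x‖₊ / C) + φ t₀ := by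
          calc φ (‖(W : L0) x‖₊ / (C * L ^ r)) ≤ φ (‖(y j : L0) x‖₊ / C / L ^ r) := by
                rw [div_div]
                exact φ.monotone (by gcongr)
            _ ≤ φ (‖(y j : L0) x‖₊ / C) / (2 * L) ^ r + φ t₀ :=
                OrliczFunction.map_div_pow_le hL hφ r _
            _ ≤ _ := by
                rw [div_eq_inv_mul]
                gcongr
                exact Finset.single_le_sum (f := fun j => φ (‖(y j : L0) x‖₊ / C))
                  (fun _ _ => zero_le) hj
        exact_mod_cast h3
    _ = (((2 * L : ℝ≥0) ^ r)⁻¹ : ℝ≥0) * ∑ j ∈ s, φ.modular C (y j : L0) + φ t₀ := by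
        rw [lintegral_add_right _ measurable_const, lintegral_const, measure_univ, mul_one,
          lintegral_const_mul'' _ (Finset.aemeasurable_fun_sum _ fun j _ =>
            φ.aemeasurable_modular C _), lintegral_finsetSum' _ fun j _ =>
            φ.aemeasurable_modular C _]
        rfl
    _ ≤ (((2 * L : ℝ≥0) ^ r)⁻¹ : ℝ≥0) * ∑ j ∈ s, 1 + φ t₀ := by
        gcongr with j hj
        exact hy j
    _ = _ := by
        rw [Finset.sum_const, nsmul_eq_mul, mul_one, ENNReal.coe_inv (by positivity), mul_comm,
          div_eq_mul_inv]
        push_cast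
        rfl

/-- A sum of functions whose pairwise infima are small in norm is almost as small as a disjoint
sum. Under `∇₂` it is much smaller than the number of its terms. -/
theorem norm_sum_le_of_norm_inf_le {s : Finset ℕ} {y : ℕ → OrliczSpace φ} {L r : ℕ} (hL : 1 ≤ L)
    {t₀ : ℝ≥0} (hφ : ∀ t, t₀ ≤ t → 2 * L * φ t ≤ φ (L * t)) {C : ℝ≥0} (hC : 0 < C)
    (hy : ∀ j, ‖y j‖ < C) (hs : s.card = (2 * L) ^ r)
    (hinf : ∀ i ∈ s, ∀ j ∈ s, i ≠ j → ‖|y i| ⊓ |y j|‖ ≤ 1 / (s.card : ℝ) ^ 2) :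
    ‖∑ j ∈ s, y j‖ ≤ C * L ^ r * (1 + φ t₀) + 1 := by
  have hcard : 0 < s.card := by rw [hs]; positivity
  have hne : s.Nonempty := Finset.card_pos.1 hcard
  set V : OrliczSpace φ := ∑ q ∈ s.offDiag, |y q.1| ⊓ |y q.2| with hV
  set W : OrliczSpace φ := (∑ j ∈ s, |y j| - V) ⊔ 0 with hW
  have hVn : ‖V‖ ≤ 1 := by
    calc ‖V‖ ≤ ∑ q ∈ s.offDiag, ‖|y q.1| ⊓ |y q.2|‖ := norm_sum_le _ _
      _ ≤ ∑ q ∈ s.offDiag, 1 / (s.card : ℝ) ^ 2 := Finset.sum_le_sum fun q hq => by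
          obtain ⟨h1, h2, h3⟩ := Finset.mem_offDiag.1 hq
          exact hinf _ h1 _ h2 h3
      _ ≤ 1 := by
          rw [Finset.sum_const, nsmul_eq_mul, mul_one_div, div_le_one (by positivity)]
          rw [Finset.offDiag_card, Nat.cast_sub (Nat.le_mul_self _)]
          push_cast
          nlinarith
  have hWpt : ∀ᵐ x, ∃ j ∈ s, |(W : L0) x| ≤ |(y j : L0) x| := by
    have h1 : ∀ᵐ x, ∀ j, ((|y j| : OrliczSpace φ) : L0) x = |(y j : L0) x| :=
      ae_all_iff.2 fun j => coeFn_abs' (y j)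
    have h2 : ∀ᵐ x, ∀ q : ℕ × ℕ, ((|y q.1| ⊓ |y q.2| : OrliczSpace φ) : L0) x =
        min (((|y q.1| : OrliczSpace φ) : L0) x) (((|y q.2| : OrliczSpace φ) : L0) x) :=
      ae_all_iff.2 fun q => coeFn_inf' _ _
    filter_upwards [h1, h2, coeFn_sup' (∑ j ∈ s, |y j| - V) 0, coeFn_sub' (∑ j ∈ s, |y j|) V,
      coeFn_sum' s (fun j => |y j|), coeFn_sum' s.offDiag (fun q => |y q.1| ⊓ |y q.2|),
      coeFn_zero' (φ := φ)] with x h1 h2 h3 h4 h5 h6 h7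
    obtain ⟨j, hj, hmax⟩ := s.exists_max_image (fun j => |(y j : L0) x|) hne
    refine ⟨j, hj, ?_⟩
    rw [h3, h4, h5, h6, h7]
    simp only [h1, h2]
    have h8 := sum_le_of_forall_le_add_sum_min s (a := fun j => |(y j : L0) x|)
      (fun _ => abs_nonneg _) j hj hmax
    rw [abs_of_nonneg (le_max_right _ _)]
    exact max_le (by linarith) (abs_nonneg _)
  have hWn : ‖W‖ ≤ (C * L ^ r : ℝ≥0) * (1 + φ t₀ : ℝ≥0) := by
    refine norm_le_mul_of_modular_le (by positivity) (by simp) ?_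
    refine (modular_le_of_forall_exists_le hWpt hL hφ (r := r) fun j =>
      modular_le_one (hy j)).trans ?_
    rw [hs]
    push_cast
    gcongr
    exact ENNReal.div_self_le_one
  have hle : |∑ j ∈ s, y j| ≤ |W + V| := by
    calc |∑ j ∈ s, y j| ≤ ∑ j ∈ s, |y j| := Finset.le_sum_of_subadditive _ abs_zero.le
          (fun a b => abs_add_le a b) _ _
      _ = (∑ j ∈ s, |y j| - V) + V := by abel
      _ ≤ W + V := by
          gcongr
          exact le_sup_left
      _ ≤ |W + V| := le_abs_self _
  calc ‖∑ j ∈ s, y j‖ ≤ ‖W + V‖ := norm_le_norm_of_abs_le_abs hle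
    _ ≤ ‖W‖ + ‖V‖ := norm_add_le _ _
    _ ≤ _ := by
      push_cast at hWn
      gcongr

end OrliczSpace

namespace OrliczHeart

variable {φ : OrliczFunction}

/-- Under `∇₂`, a norm bounded sequence in the heart that converges to zero almost everywhere is
weakly null: otherwise a functional would grow linearly along the sums of some almost disjoint
subsequence, contrary to `OrliczSpace.norm_sum_le_of_norm_inf_le`. -/
theorem tendsto_map_zero_of_tendsto_ae (hφ : φ.Nabla2) {g : OrliczHeart φ →ₗ[ℝ] ℝ}
    (hg : g ∈ normDual (OrliczHeart φ)) {y : ℕ → OrliczHeart φ} (hy : NormBounded y)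
    (hlim : ∀ᵐ x, Tendsto (fun n => ((y n : OrliczSpace φ) : L0) x) atTop (𝓝 0)) :
    Tendsto (fun n => g (y n)) atTop (𝓝 0) := by
  obtain ⟨L, hL, t₀, hL'⟩ := hφ
  obtain ⟨C₀, hC₀⟩ := hy
  set C : ℝ≥0 := C₀.toNNReal + 1 with hCdef
  have hC : 0 < C := by positivity
  have hyC : ∀ n, ‖(y n : OrliczSpace φ)‖ < C := fun n => by
    have h1 := (hC₀ n).trans (Real.le_coe_toNNReal C₀)
    rw [hCdef]
    push_cast
    exact h1.trans_lt (lt_add_one _)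
  let G : StrongDual ℝ (OrliczHeart φ) := ⟨g, hg⟩
  have hlim' : ∀ i, Tendsto (fun n => ‖|(y i : OrliczSpace φ)| ⊓ |(y n : OrliczSpace φ)|‖) atTop
      (𝓝 0) := by
    intro i
    have h1 : ∀ᵐ x, ∀ n,
        ((|(y i : OrliczSpace φ)| ⊓ |(y n : OrliczSpace φ)| : OrliczSpace φ) : L0) x =
        min |((y i : OrliczSpace φ) : L0) x| |((y n : OrliczSpace φ) : L0) x| := by
      refine ae_all_iff.2 fun n => ?_
      filter_upwards [OrliczSpace.coeFn_inf' |(y i : OrliczSpace φ)| |(y n : OrliczSpace φ)|,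
        OrliczSpace.coeFn_abs' (y i : OrliczSpace φ),
        OrliczSpace.coeFn_abs' (y n : OrliczSpace φ)] with x h1 h2 h3
      rw [h1, h2, h3]
    refine tendsto_norm_zero (y i).2 (fun n => ?_) ?_
    · filter_upwards [h1] with x h1
      rw [h1, abs_of_nonneg (le_min (abs_nonneg _) (abs_nonneg _))]
      exact min_le_left _ _
    · filter_upwards [h1, hlim] with x h1 h2
      simp only [h1]
      refine squeeze_zero (fun n => le_min (abs_nonneg _) (abs_nonneg _))
        (fun n => min_le_right _ _) ?_
      simpa using h2.abs
  by_contra hcon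
  rw [Metric.tendsto_atTop] at hcon
  push Not at hcon
  obtain ⟨ε, hε, hN⟩ := hcon
  -- choose `r` so large that `2 ^ r` exceeds the quotient of the two competing bounds
  obtain ⟨r, hr⟩ := pow_unbounded_of_one_lt (‖G‖ * (C * (1 + φ t₀) + 1) / ε)
    (show (1 : ℝ) < 2 by norm_num)
  set N : ℕ := (2 * L) ^ r with hNdef
  have hNpos : 0 < N := by positivity
  obtain ⟨f, hf1, hf2⟩ := exists_seq_of_forall_finset_exists (α := ℕ) (fun n => ε ≤ |g (y n)|)
    (fun i n => i < n ∧ ‖|(y i : OrliczSpace φ)| ⊓ |(y n : OrliczSpace φ)|‖ ≤ 1 / (N : ℝ) ^ 2) (by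
    intro s _
    have h1 : ∀ᶠ n in atTop, ∀ i ∈ s, i < n ∧
        ‖|(y i : OrliczSpace φ)| ⊓ |(y n : OrliczSpace φ)|‖ ≤ 1 / (N : ℝ) ^ 2 := by
      rw [Filter.eventually_all_finset]
      intro i _
      exact (eventually_gt_atTop i).and
        ((hlim' i).eventually (ge_mem_nhds (by positivity)))
    obtain ⟨n₀, hn₀⟩ := eventually_atTop.1 h1
    obtain ⟨n, hn, h2⟩ := hN n₀
    rw [Real.dist_eq, sub_zero] at h2
    exact ⟨n, h2, hn₀ n hn⟩)
  let z : ℕ → OrliczHeart φ := fun n => (SignType.sign (g (y (f n))) : ℝ) • y (f n)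
  have hgz : ∀ n, g (z n) = |g (y (f n))| := fun n => by
    simp only [z, map_smul, smul_eq_mul]
    exact sign_mul_self _
  have hzabs : ∀ n, |(z n : OrliczSpace φ)| = |(y (f n) : OrliczSpace φ)| := fun n => by
    have h0 : g (y (f n)) ≠ 0 := abs_pos.1 (hε.trans_le (hf1 n))
    rcases lt_or_gt_of_ne h0 with h | h
    · simp [z, sign_neg h]
    · simp [z, sign_pos h]
  have hznorm : ∀ n, ‖(z n : OrliczSpace φ)‖ < C := fun n => by
    rw [← norm_abs_eq_norm, hzabs, norm_abs_eq_norm]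
    exact hyC _
  have hsum := OrliczSpace.norm_sum_le_of_norm_inf_le (s := Finset.range N)
    (y := fun n => (z n : OrliczSpace φ)) (r := r) hL hL' hC hznorm (by simp [hNdef]) (by
      intro i _ j _ hij
      simp only [hzabs, Finset.card_range]
      rcases lt_or_gt_of_ne hij with h | h
      · exact (hf2 i j h).2
      · rw [inf_comm]
        exact (hf2 j i h).2)
  have h1 : (N : ℝ) * ε ≤ g (∑ n ∈ Finset.range N, z n) := by
    rw [map_sum]
    calc (N : ℝ) * ε = ∑ n ∈ Finset.range N, ε := by simp
      _ ≤ _ := Finset.sum_le_sum fun n _ => (hf1 n).trans_eq (hgz n).symm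
  have h2 : g (∑ n ∈ Finset.range N, z n) ≤ ‖G‖ * (C * L ^ r * (1 + φ t₀) + 1) := by
    refine (le_abs_self _).trans ((G.le_opNorm _).trans ?_)
    gcongr
    rw [Submodule.coe_norm, Submodule.coe_sum]
    exact hsum
  have hLr : (1 : ℝ) ≤ (L : ℝ) ^ r := one_le_pow₀ (by exact_mod_cast hL)
  have h3 : (N : ℝ) = 2 ^ r * L ^ r := by
    rw [hNdef]
    push_cast
    rw [mul_pow]
  rw [div_lt_iff₀ hε] at hr
  have h4 : ‖G‖ * (C * L ^ r * (1 + φ t₀) + 1) ≤ ‖G‖ * (C * (1 + φ t₀) + 1) * L ^ r := by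
    rw [mul_assoc ‖G‖]
    refine mul_le_mul_of_nonneg_left ?_ (norm_nonneg G)
    linarith
  have h5 := mul_lt_mul_of_pos_right hr (zero_lt_one.trans_le hLr)
  rw [h3] at h1
  linarith

/-- Under `∇₂`, a norm bounded sequence in the heart all of whose subsequences have Cesàro means
converging to zero almost everywhere is weakly null. -/
theorem sigmaNull_of_forall_subseq_cesaroMeans (hφ : φ.Nabla2) {y : ℕ → OrliczHeart φ}
    (hy : NormBounded y)
    (hlim : ∀ k : ℕ → ℕ, StrictMono k → ∀ᵐ x,
      Tendsto (cesaroMeans fun n => ((y (k n) : OrliczSpace φ) : L0) x) atTop (𝓝 0)) :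
    SigmaNull (normDual (OrliczHeart φ)) y := by
  intro g hg
  obtain ⟨C, hC⟩ := hy
  refine tendsto_zero_of_forall_subseq_tendsto_cesaroMeans fun k hk => ?_
  have h := tendsto_map_zero_of_tendsto_ae hφ hg (y := fun m => cesaroMeans (y ∘ k) m)
    ⟨C, fun m => norm_cesaroMeans_le (fun n => hC (k n)) m⟩ ?_
  · refine h.congr fun m => ?_
    rw [map_cesaroMeans]
    rfl
  · have h1 : ∀ᵐ x, ∀ m, (((cesaroMeans (y ∘ k) m : OrliczHeart φ) : OrliczSpace φ) : L0) x =
        cesaroMeans (fun n => ((y (k n) : OrliczSpace φ) : L0) x) m := by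
      refine ae_all_iff.2 fun m => ?_
      have h2 := map_cesaroMeans (OrliczHeart φ).subtype (y ∘ k) m
      simp only [Submodule.subtype_apply] at h2
      rw [h2]
      filter_upwards [OrliczSpace.coeFn_cesaroMeans (fun n => (y (k n) : OrliczSpace φ)) m]
        with x hx
      rw [← cesaroMeans_apply]
      exact hx
    filter_upwards [h1, hlim k hk] with x h1 h2
    simpa only [h1] using h2

end OrliczHeart

/-! ### Property `(H)` and `∇₂` imply `oBSP` -/

namespace OrliczSpace

variable {φ : OrliczFunction}

theorem exists_modular_lt_top (f : OrliczSpace φ) :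
    ∃ l : ℝ≥0, 0 < l ∧ φ.modular l (f : L0) < ⊤ :=
  ⟨‖f‖₊ + 1, by positivity, (modular_le_one (by simp)).trans_lt ENNReal.one_lt_top⟩

/-- The function `f`, replaced by zero where `|f| > a`. -/
noncomputable def trunc (f : OrliczSpace φ) (a : ℕ) : OrliczSpace φ :=
  ofFun ({x | |(f : L0) x| ≤ a}.indicator (f : L0))
    ((f : L0).stronglyMeasurable.indicator
      (measurableSet_le (f : L0).measurable.abs measurable_const)).aestronglyMeasurable (by
    obtain ⟨l, hl, h⟩ := exists_modular_lt_top f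
    refine ⟨l, hl, (lintegral_mono fun x => ?_).trans_lt h⟩
    have : ‖{x | |(f : L0) x| ≤ a}.indicator (f : L0) x‖₊ ≤ ‖(f : L0) x‖₊ :=
      norm_indicator_le_norm_self (f : L0) x
    exact ENNReal.coe_le_coe.2 (φ.monotone (by gcongr)))

theorem coeFn_trunc (f : OrliczSpace φ) (a : ℕ) :
    (trunc f a : L0) =ᵐ[volume] {x | |(f : L0) x| ≤ a}.indicator (f : L0) := coeFn_ofFun

theorem abs_trunc_le (f : OrliczSpace φ) (a : ℕ) :
    ∀ᵐ x, |(trunc f a : L0) x| ≤ |(f : L0) x| := by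
  filter_upwards [coeFn_trunc f a] with x hx
  rw [hx]
  exact norm_indicator_le_norm_self (f : L0) x

theorem trunc_mem_heart (f : OrliczSpace φ) (a : ℕ) : trunc f a ∈ OrliczHeart φ := by
  refine OrliczHeart.mem_of_bounded (K := a) ?_
  filter_upwards [coeFn_trunc f a] with x hx
  rw [hx]
  by_cases h : |(f : L0) x| ≤ a
  · rw [indicator_of_mem (by exact h)]
    exact_mod_cast h
  · rw [indicator_of_notMem (by exact h)]
    simp

theorem norm_trunc_le (f : OrliczSpace φ) (a : ℕ) : ‖trunc f a‖ ≤ ‖f‖ :=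
  norm_le_norm_of_ae (abs_trunc_le f a)

/-- Above a suitable level the tail of `f` is small in modular and has small support. -/
theorem exists_tail_small (f : OrliczSpace φ) {M : ℝ≥0} (hf : φ.modular M (f : L0) ≠ ⊤)
    {ε : ℝ≥0∞} (hε : 0 < ε) :
    ∃ a : ℕ, ∫⁻ x, (φ (‖(f : L0) x - (trunc f a : L0) x‖₊ / M) : ℝ≥0∞) ≤ ε ∧
      volume {x | (a : ℝ) < |(f : L0) x|} ≤ ε := by
  have hmeas : ∀ a : ℕ, MeasurableSet {x | (a : ℝ) < |(f : L0) x|} := fun a =>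
    measurableSet_lt measurable_const (f : L0).measurable.abs
  have h1 : Tendsto (fun a : ℕ => volume {x | (a : ℝ) < |(f : L0) x|}) atTop (𝓝 0) := by
    have h := tendsto_measure_iInter_atTop (μ := (volume : Measure unitInterval))
      (s := fun a : ℕ => {x | (a : ℝ) < |(f : L0) x|})
      (fun a => (hmeas a).nullMeasurableSet) (fun a b hab x hx =>
        lt_of_le_of_lt (show (a : ℝ) ≤ b by exact_mod_cast hab) hx) ⟨0, measure_ne_top _ _⟩
    have h2 : ⋂ a : ℕ, {x | (a : ℝ) < |(f : L0) x|} = ∅ := by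
      refine eq_empty_of_forall_notMem fun x hx => ?_
      obtain ⟨n, hn⟩ := exists_nat_gt |(f : L0) x|
      exact lt_asymm hn (mem_iInter.1 hx n)
    rwa [h2, measure_empty] at h
  have h2 := tendsto_setLIntegral_zero hf h1
  obtain ⟨a, h3, h4⟩ := ((h2.eventually (ge_mem_nhds hε)).and
    (h1.eventually (ge_mem_nhds hε))).exists
  refine ⟨a, le_trans ?_ h3, h4⟩
  rw [← lintegral_indicator (hmeas a)]
  refine lintegral_mono_ae ?_
  filter_upwards [coeFn_trunc f a] with x hx
  rw [hx]
  by_cases h : |(f : L0) x| ≤ a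
  · rw [indicator_of_mem (by exact h)]
    simp [φ.map_zero]
  · rw [indicator_of_notMem (by exact h), indicator_of_mem (by exact not_le.1 h), sub_zero]

theorem lintegral_rpow_le {p : ℝ} (hp : 0 ≤ p) {C : ℝ≥0}
    (hC : ∀ t : ℝ≥0, (t : ℝ) ^ p ≤ C * (1 + φ t)) {f : OrliczSpace φ} {M : ℝ≥0}
    (hf : φ.modular M (f : L0) ≤ 1) {u : unitInterval → ℝ}
    (hu : ∀ x, 0 ≤ u x ∧ u x ≤ |(f : L0) x| / M) :
    ∫⁻ x, ENNReal.ofReal (u x ^ p) ≤ (C * 2 : ℝ≥0) := by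
  calc ∫⁻ x, ENNReal.ofReal (u x ^ p)
      ≤ ∫⁻ x, C * (1 + (φ (‖(f : L0) x‖₊ / M) : ℝ≥0∞)) := by
        refine lintegral_mono fun x => ?_
        have h1 : u x ^ p ≤ C * (1 + φ (‖(f : L0) x‖₊ / M)) := by
          refine le_trans ?_ (hC _)
          exact Real.rpow_le_rpow (hu x).1 (by simpa using (hu x).2) hp
        refine (ENNReal.ofReal_le_ofReal h1).trans_eq ?_
        have h2 : (C * (1 + φ (‖(f : L0) x‖₊ / M)) : ℝ) =
          ((C * (1 + φ (‖(f : L0) x‖₊ / M)) : ℝ≥0) : ℝ) := by push_cast; rfl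
        rw [h2, ENNReal.ofReal_coe_nnreal]
        push_cast
        rfl
    _ = C * (1 + φ.modular M (f : L0)) := by
        have h : AEMeasurable (fun x => 1 + (φ (‖(f : L0) x‖₊ / M) : ℝ≥0∞)) volume :=
          aemeasurable_const.add (φ.aemeasurable_modular M _)
        rw [lintegral_const_mul'' _ h, lintegral_add_left measurable_const]
        simp [OrliczFunction.modular]
    _ ≤ C * (1 + 1) := by gcongr
    _ = _ := by push_cast; norm_num

/-- Komlós' theorem in `L^φ` under `∇₂`: the averages of all further subsequences converge. -/
theorem exists_subseq_forall_subseq_tendsto_cesaroMeans (hφ : φ.Nabla2) {f : ℕ → OrliczSpace φ}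
    {M : ℝ≥0} (hM : 0 < M) (hf : ∀ n, φ.modular M (f n : L0) ≤ 1) :
    ∃ k : ℕ → ℕ, StrictMono k ∧ ∃ w : unitInterval → ℝ, Measurable w ∧
      ∀ l : ℕ → ℕ, StrictMono l → ∀ᵐ x,
        Tendsto (cesaroMeans fun n => (f (k (l n)) : L0) x) atTop (𝓝 (w x)) := by
  obtain ⟨p, hp1, hp2, C, hC⟩ := hφ.exists_rpow_le
  have hM' : (0 : ℝ) < M := hM
  have hbd : ∀ (n : ℕ) (ε : ℝ), |ε| = 1 → ∫⁻ x,
      ENNReal.ofReal ((max (ε * (f n : L0) x) 0 / M) ^ p) ≤ (C * 2 : ℝ≥0) := fun n ε hε =>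
    lintegral_rpow_le (by linarith) hC (hf n) fun x => by
      refine ⟨by positivity, ?_⟩
      gcongr
      refine max_le ((le_abs_self _).trans_eq ?_) (abs_nonneg _)
      rw [abs_mul, hε, one_mul]
  have hmeas : ∀ (n : ℕ) (ε : ℝ), Measurable fun x => max (ε * (f n : L0) x) 0 / (M : ℝ) :=
    fun n ε => (((f n : L0).measurable.const_mul ε).max measurable_const).div_const _
  have hnn : ∀ (n : ℕ) (ε : ℝ) x, 0 ≤ max (ε * (f n : L0) x) 0 / (M : ℝ) := fun n ε x => by
    positivity
  obtain ⟨k₁, hk₁, w₁, hw₁, h₁⟩ := exists_subseq_forall_subseq_tendsto_average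
    (fun n => hmeas n 1) (fun n => hnn n 1) hp1 hp2 (fun n => hbd n 1 (by simp))
  obtain ⟨k₂, hk₂, w₂, hw₂, h₂⟩ := exists_subseq_forall_subseq_tendsto_average
    (fun n => hmeas (k₁ n) (-1)) (fun n => hnn (k₁ n) (-1)) hp1 hp2
    (fun n => hbd (k₁ n) (-1) (by simp))
  refine ⟨k₁ ∘ k₂, hk₁.comp hk₂, fun x => M * (w₁ x - w₂ x), (hw₁.sub hw₂).const_mul _,
    fun l hl => ?_⟩
  filter_upwards [h₁ (k₂ ∘ l) (hk₂.comp hl), h₂ l hl] with x h1 h2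
  rw [tendsto_cesaroMeans_iff]
  refine ((h1.sub h2).const_mul (M : ℝ)).congr fun m => ?_
  rw [← sub_div, ← Finset.sum_sub_distrib, ← mul_div_assoc, Finset.mul_sum]
  congr 1
  refine Finset.sum_congr rfl fun n _ => ?_
  simp only [Function.comp_apply, one_mul, neg_mul]
  rw [← sub_div, mul_div_cancel₀ _ hM'.ne']
  rcases le_total 0 ((f (k₁ (k₂ (l n))) : L0) x) with h | h
  · rw [max_eq_left h, max_eq_right (by linarith), sub_zero]
  · rw [max_eq_right h, max_eq_left (by linarith)]
    ring

/-- A Fatou property of the modular. -/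
theorem lintegral_modular_le_one_of_tendsto_ae {A : ℕ → OrliczSpace φ} {M : ℝ≥0}
    (hA : ∀ m, φ.modular M (A m : L0) ≤ 1) {w : unitInterval → ℝ}
    (hlim : ∀ᵐ x, Tendsto (fun m => (A m : L0) x) atTop (𝓝 (w x))) :
    ∫⁻ x, (φ (‖w x‖₊ / (2 * M)) : ℝ≥0∞) ≤ 1 := by
  calc ∫⁻ x, (φ (‖w x‖₊ / (2 * M)) : ℝ≥0∞)
      ≤ ∫⁻ x, liminf (fun m => (φ (‖(A m : L0) x‖₊ / M) : ℝ≥0∞)) atTop := by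
        refine lintegral_mono_ae ?_
        filter_upwards [hlim] with x hx
        rcases eq_or_ne (w x) 0 with h0 | h0
        · simp [h0, φ.map_zero]
        refine le_liminf_of_le (by isBoundedDefault) ?_
        have h1 : ‖w x‖₊ / 2 < ‖w x‖₊ := NNReal.half_lt_self (by simpa using h0)
        filter_upwards [hx.nnnorm.eventually (lt_mem_nhds h1)] with m hm
        refine ENNReal.coe_le_coe.2 (φ.monotone ?_)
        rw [← div_div]
        gcongr
    _ ≤ liminf (fun m => φ.modular M (A m : L0)) atTop :=
        lintegral_liminf_le' fun m => φ.aemeasurable_modular M _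
    _ ≤ 1 := liminf_le_of_frequently_le' (Frequently.of_forall hA)

end OrliczSpace

open OrliczSpace in
/-- Let `f` be norm bounded, and let all subsequences have averages converging to `w`. Cutting off
`f n` at a level beyond which it has modular at most `2⁻ⁿ`, and `w` at level `n`, the differences
form a weakly null sequence of bounded functions, to which `(H)` applies; the averages of the parts
cut off are dominated in modular by a convergent series. -/
theorem OrliczFunction.HasPropertyH.hasOBSP {φ : OrliczFunction} (hH : φ.HasPropertyH)
    (hφ : φ.Nabla2) : HasOBSP (OrliczSpace φ) := by
  intro f₀ hf₀
  obtain ⟨C₀, hC₀⟩ := hf₀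
  set M : ℝ≥0 := C₀.toNNReal + 1 with hMdef
  have hM : 0 < M := by positivity
  have hCM : C₀ < M := by
    rw [hMdef]
    push_cast
    exact (Real.le_coe_toNNReal C₀).trans_lt (lt_add_one _)
  obtain ⟨k₁, hk₁, w₀, hw₀, hlim⟩ := exists_subseq_forall_subseq_tendsto_cesaroMeans hφ hM
    (f := f₀) fun n => modular_le_one ((hC₀ n).trans_lt hCM)
  set f : ℕ → OrliczSpace φ := fun n => f₀ (k₁ n) with hf
  have hfC : ∀ n, ‖f n‖ ≤ C₀ := fun n => hC₀ _
  have hfmod : ∀ n, φ.modular M (f n : L0) ≤ 1 := fun n => modular_le_one ((hfC n).trans_lt hCM)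
  have hcoeC : ∀ k : ℕ → ℕ, ∀ᵐ x, ∀ m, ((cesaroMeans (f ∘ k) m : OrliczSpace φ) : L0) x =
      cesaroMeans (fun n => (f (k n) : L0) x) m := fun k => by
    refine ae_all_iff.2 fun m => ?_
    filter_upwards [coeFn_cesaroMeans (f ∘ k) m] with x hx
    rw [hx, cesaroMeans_apply]
    rfl
  -- the limit function belongs to `L^φ`
  have hwmod : ∫⁻ x, (φ (‖w₀ x‖₊ / (2 * M)) : ℝ≥0∞) ≤ 1 := by
    refine lintegral_modular_le_one_of_tendsto_ae (A := fun m => cesaroMeans (f ∘ id) m)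
      (fun m => modular_le_one ((norm_cesaroMeans_le (fun n => hfC n) m).trans_lt hCM)) ?_
    filter_upwards [hcoeC id, hlim id strictMono_id] with x h1 h2
    simpa only [h1] using h2
  let w : OrliczSpace φ := ofFun w₀ hw₀.aestronglyMeasurable
    ⟨2 * M, by positivity, hwmod.trans_lt ENNReal.one_lt_top⟩
  have hw : (w : L0) =ᵐ[volume] w₀ := coeFn_ofFun
  -- the truncation levels
  have hex : ∀ n, ∃ a : ℕ, ∫⁻ x, (φ (‖(f n : L0) x - (trunc (f n) a : L0) x‖₊ / M) : ℝ≥0∞) ≤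
      2⁻¹ ^ n ∧ volume {x | (a : ℝ) < |(f n : L0) x|} ≤ 2⁻¹ ^ n := fun n =>
    exists_tail_small (f n) ((hfmod n).trans_lt ENNReal.one_lt_top).ne
      (ENNReal.pow_pos (by simp) n)
  choose a ha1 ha2 using hex
  have hgeom : ∑' n : ℕ, (2⁻¹ : ℝ≥0∞) ^ n ≠ ⊤ := by
    rw [ENNReal.tsum_geometric, ENNReal.one_sub_inv_two]
    simp
  let y : ℕ → OrliczHeart φ := fun n =>
    ⟨trunc (f n) (a n) - trunc w n, sub_mem (trunc_mem_heart _ _) (trunc_mem_heart _ _)⟩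
  have hy : ∀ᵐ x, ∀ n, ((y n : OrliczSpace φ) : L0) x =
      (trunc (f n) (a n) : L0) x - (trunc w n : L0) x := ae_all_iff.2 fun n => coeFn_sub' _ _
  have hyb : NormBounded y := ⟨C₀ + ‖w‖, fun n => (norm_sub_le _ _).trans
    (add_le_add ((norm_trunc_le _ _).trans (hfC n)) (norm_trunc_le _ _))⟩
  -- almost everywhere the truncations are eventually inactive
  have hftr : ∀ᵐ x, ∀ᶠ n in atTop, (trunc (f n) (a n) : L0) x = (f n : L0) x := by
    have h1 := ae_eventually_notMem
      (ne_top_of_le_ne_top hgeom (ENNReal.tsum_le_tsum ha2))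
    filter_upwards [h1, ae_all_iff.2 fun n => coeFn_trunc (f n) (a n)] with x h1 h2
    filter_upwards [h1] with n hn
    rw [h2, indicator_of_mem (by simpa using hn)]
  have hwtr : ∀ᵐ x, ∀ᶠ n : ℕ in atTop, (trunc w n : L0) x = (w : L0) x := by
    filter_upwards [ae_all_iff.2 fun n => coeFn_trunc w n] with x h1
    obtain ⟨N, hN⟩ := exists_nat_ge |(w : L0) x|
    filter_upwards [eventually_ge_atTop N] with n hn
    rw [h1, indicator_of_mem]
    exact hN.trans (by exact_mod_cast hn)
  have hynull : SigmaNull (normDual (OrliczHeart φ)) y := by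
    refine OrliczHeart.sigmaNull_of_forall_subseq_cesaroMeans hφ hyb fun k hk => ?_
    filter_upwards [hy, hftr, hwtr, hlim k hk, hw] with x h1 h2 h3 h4 h5
    have h6 : Tendsto (fun n => ((y (k n) : OrliczSpace φ) : L0) x - ((f (k n) : L0) x - w₀ x))
        atTop (𝓝 0) := by
      refine tendsto_const_nhds.congr' ?_
      filter_upwards [hk.tendsto_atTop.eventually h2, hk.tendsto_atTop.eventually h3]
        with n h6 h7
      rw [h1, h6, h7, h5, sub_self]
    have h7 := (tendsto_cesaroMeans_of_tendsto h6).add (h4.sub_const (w₀ x))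
    rw [sub_self, add_zero] at h7
    refine h7.congr fun m => ?_
    have h8 := cesaroMeans_sub (fun n => (f (k n) : L0) x) (fun _ => w₀ x) m
    rw [cesaroMeans_const] at h8
    rw [← h8, ← cesaroMeans_add]
    simp
  obtain ⟨k, hk, H, -, hHk⟩ := hH y hynull
  -- the averages of the parts cut off from `f`
  obtain ⟨R, -, hR⟩ := exists_forall_abs_le (φ := φ)
    (v := fun m x => cesaroMeans (fun n => (f (k n) : L0) x - (trunc (f (k n)) (a (k n)) : L0) x) m)
    (l := M)
    (fun m => by
      simp only [cesaroMeans, smul_eq_mul]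
      exact (Finset.aemeasurable_fun_sum _ fun n _ => (f (k n) : L0).measurable.aemeasurable.sub
        (trunc (f (k n)) (a (k n)) : L0).measurable.aemeasurable).const_mul _)
    hM
    (S := fun x => ∑' n, (φ (‖(f n : L0) x - (trunc (f n) (a n) : L0) x‖₊ / M) : ℝ≥0∞))
    (AEMeasurable.tsum fun n => by
      have h : Measurable fun x => ‖(f n : L0) x - (trunc (f n) (a n) : L0) x‖₊ / M :=
        ((f n : L0).measurable.sub (trunc (f n) (a n) : L0).measurable).nnnorm.div_const M
      exact (measurable_coe_nnreal_ennreal.comp (φ.measurable.comp h)).aemeasurable)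
    (by
      rw [lintegral_tsum fun n => by
        have h : Measurable fun x => ‖(f n : L0) x - (trunc (f n) (a n) : L0) x‖₊ / M :=
          ((f n : L0).measurable.sub (trunc (f n) (a n) : L0).measurable).nnnorm.div_const M
        exact (measurable_coe_nnreal_ennreal.comp (φ.measurable.comp h)).aemeasurable]
      exact ne_top_of_le_ne_top hgeom (ENNReal.tsum_le_tsum ha1))
    (fun m => ae_of_all _ fun x => by
      -- an average is dominated by the largest of its terms
      obtain ⟨j, -, hj⟩ := (Finset.range (m + 1)).exists_max_image
        (fun n => |(f (k n) : L0) x - (trunc (f (k n)) (a (k n)) : L0) x|) ⟨0, by simp⟩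
      refine le_trans (ENNReal.coe_le_coe.2 (φ.monotone ?_)) (ENNReal.le_tsum (k j))
      gcongr
      rw [← NNReal.coe_le_coe, coe_nnnorm, coe_nnnorm, Real.norm_eq_abs, Real.norm_eq_abs]
      refine (abs_cesaroMeans_le _ m).trans ?_
      rw [← cesaroMeans_const (|(f (k j) : L0) x - (trunc (f (k j)) (a (k j)) : L0) x|) m]
      unfold cesaroMeans
      refine smul_le_smul_of_nonneg_left (Finset.sum_le_sum fun n hn => hj n hn) (by positivity))
  refine ⟨k₁ ∘ k, hk₁.comp hk, w, ?_⟩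
  change OrderConverges (cesaroMeans (f ∘ k)) w
  have hyC : ∀ᵐ x, ∀ m, |cesaroMeans (fun n => ((y (k n) : OrliczSpace φ) : L0) x) m| ≤
      (H : L0) x := by
    refine ae_all_iff.2 fun m => ?_
    filter_upwards [abs_le_iff_ae.1 (hHk m),
      coeFn_cesaroMeans (fun n => (y (k n) : OrliczSpace φ)) m] with x h1 h2
    rwa [h2, cesaroMeans_apply] at h1
  refine orderConverges_of_tendsto_ae (H := H + |w| + |w| + R) (fun m => ?_) ?_
  · filter_upwards [hcoeC k, hyC, hR, hy, ae_all_iff.2 fun n => abs_trunc_le w n,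
      coeFn_add' (H + |w| + |w|) R, coeFn_add' (H + |w|) |w|, coeFn_add' H |w|, coeFn_abs' w]
      with x h1 h2 h3 h4 h5 h6 h7 h8 h9
    rw [h1, h6, h7, h8, h9]
    have h10 : cesaroMeans (fun n => (f (k n) : L0) x) m =
        cesaroMeans (fun n => ((y (k n) : OrliczSpace φ) : L0) x) m +
        cesaroMeans (fun n => (trunc w (k n) : L0) x) m +
        cesaroMeans (fun n => (f (k n) : L0) x - (trunc (f (k n)) (a (k n)) : L0) x) m := by
      rw [← cesaroMeans_add, ← cesaroMeans_add]
      congr 1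
      funext n
      rw [h4]
      ring
    have h11 : |cesaroMeans (fun n => (trunc w (k n) : L0) x) m| ≤ |(w : L0) x| :=
      (abs_cesaroMeans_le _ m).trans
        ((cesaroMeans_mono (fun n => h5 (k n)) m).trans_eq (cesaroMeans_const _ m))
    have h12 := abs_le.1 (h2 m)
    have h13 := abs_le.1 (h3 m)
    have h14 := abs_le.1 h11
    have h15 := neg_abs_le ((w : L0) x)
    have h16 := le_abs_self ((w : L0) x)
    rw [h10, abs_le]
    constructor <;> linarith [h12.1, h12.2, h13.1, h13.2, h14.1, h14.2]
  · filter_upwards [hcoeC k, hlim k hk, hw] with x h1 h2 h3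
    simp only [h1, h3]
    exact h2

/-! ### Independent identically distributed sequences in the Orlicz heart -/

open ProbabilityTheory in
/-- On the unit interval there is an independent sequence with a prescribed discrete law. -/
theorem exists_iIndepFun_map_eq (μ : Measure ℕ) [IsProbabilityMeasure μ] :
    ∃ K : ℕ → unitInterval → ℕ, (∀ n, Measurable (K n)) ∧ (∀ n, volume.map (K n) = μ) ∧
      iIndepFun K volume := by
  obtain ⟨X, hX, hXmap⟩ := Measure.exists_measurable_map_eq (Measure.infinitePi fun _ : ℕ => μ)
  have hK : ∀ n, Measurable fun t => X t n := fun n => (measurable_pi_apply n).comp hX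
  have hmap : ∀ n, volume.map (fun t => X t n) = μ := fun n => by
    rw [← (measurePreserving_eval_infinitePi (fun _ : ℕ => μ) n).map_eq, ← hXmap,
      Measure.map_map (measurable_pi_apply n) hX]
    rfl
  refine ⟨fun n t => X t n, hK, hmap, ?_⟩
  rw [iIndepFun_iff_map_fun_eq_infinitePi_map hK]
  simp only [hmap]
  exact hXmap

/-- For events that are pairwise independent and of the same small probability, the integral of a
function that is at least `a m` on the `m`-th event is, up to a factor, at least the sum that one
would get if the events were disjoint. -/
theorem sum_le_lintegral_of_pairwise_indep {Ω : Type*} [MeasurableSpace Ω] {ν : Measure Ω}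
    {B : ℕ → Set Ω} (hB : ∀ m, MeasurableSet (B m)) {P : ℝ≥0} (hP : ∀ m, ν (B m) = P)
    (hPP : ∀ m j, m ≠ j → ν (B m ∩ B j) = P * P) {N : ℕ} (hN : N * P ≤ 1 / 2) {ψ : Ω → ℝ≥0∞}
    {a : ℕ → ℝ≥0∞} (ha : ∀ m < N, ∀ᵐ x ∂ν, x ∈ B m → a m ≤ ψ x) :
    ∑ m ∈ Finset.range N, (P / 2 : ℝ≥0) * a m ≤ ∫⁻ x, ψ x ∂ν := by
  have hC : ∀ m, MeasurableSet (disjointed B m) := fun m => MeasurableSet.disjointed hB m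
  have hCm : ∀ m < N, ((P / 2 : ℝ≥0) : ℝ≥0∞) ≤ ν (disjointed B m) := by
    intro m hm
    have h1 : B m ⊆ disjointed B m ∪ ⋃ j ∈ Finset.range m, B m ∩ B j := by
      intro x hx
      by_cases h : ∃ j < m, x ∈ B j
      · obtain ⟨j, hj, hxj⟩ := h
        exact Or.inr (mem_biUnion (Finset.mem_coe.2 (Finset.mem_range.2 hj)) ⟨hx, hxj⟩)
      · push Not at h
        refine Or.inl ?_
        rw [disjointed_eq_inter_compl]
        exact ⟨hx, mem_iInter₂.2 fun j hj => h j hj⟩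
    have h2 : ν (⋃ j ∈ Finset.range m, B m ∩ B j) ≤ (P / 2 : ℝ≥0) := by
      calc _ ≤ ∑ j ∈ Finset.range m, ν (B m ∩ B j) := measure_biUnion_finset_le _ _
        _ = ∑ j ∈ Finset.range m, ((P * P : ℝ≥0) : ℝ≥0∞) := Finset.sum_congr rfl fun j hj => by
            rw [hPP m j (Finset.mem_range.1 hj).ne']
            push_cast
            rfl
        _ = ((m * P * P : ℝ≥0) : ℝ≥0∞) := by
            rw [Finset.sum_const, Finset.card_range, nsmul_eq_mul]
            push_cast
            ring
        _ ≤ (P / 2 : ℝ≥0) := by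
            refine ENNReal.coe_le_coe.2 ?_
            calc m * P * P ≤ N * P * P := by gcongr
              _ ≤ 1 / 2 * P := by gcongr
              _ = P / 2 := by ring
    have h3 : ((P / 2 : ℝ≥0) : ℝ≥0∞) + (P / 2 : ℝ≥0) ≤ ν (disjointed B m) + (P / 2 : ℝ≥0) := by
      rw [← ENNReal.coe_add, add_halves, ← hP m]
      exact (measure_mono h1).trans ((measure_union_le _ _).trans (by gcongr))
    exact (ENNReal.add_le_add_iff_right ENNReal.coe_ne_top).1 h3
  calc ∑ m ∈ Finset.range N, (P / 2 : ℝ≥0) * a m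
      ≤ ∑ m ∈ Finset.range N, ∫⁻ x in disjointed B m, ψ x ∂ν := by
        refine Finset.sum_le_sum fun m hm => ?_
        have hm' := Finset.mem_range.1 hm
        calc (P / 2 : ℝ≥0) * a m ≤ a m * ν (disjointed B m) := by
              rw [mul_comm]
              gcongr
              exact hCm m hm'
          _ = ∫⁻ _ in disjointed B m, a m ∂ν := (setLIntegral_const _ _).symm
          _ ≤ _ := by
              refine lintegral_mono_ae ((ae_restrict_iff' (hC m)).2 ?_)
              filter_upwards [ha m hm'] with x hx hxm using hx (disjointed_subset B m hxm)
    _ = ∫⁻ x in ⋃ m ∈ Finset.range N, disjointed B m, ψ x ∂ν :=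
        (lintegral_biUnion_finset (fun i _ j _ hij => disjoint_disjointed B hij)
          (fun m _ => hC m) _).symm
    _ ≤ _ := setLIntegral_le_lintegral _ _

section IID

open ProbabilityTheory OrliczSpace

variable {φ : OrliczFunction} {μ : Measure ℕ} {K : ℕ → unitInterval → ℕ}

theorem integrable_of_modular_lt_top [IsProbabilityMeasure μ] {h : ℕ → ℝ≥0}
    (hh : ∫⁻ i, (φ (h i) : ℝ≥0∞) ∂μ < ⊤) :
    Integrable (fun i => (h i : ℝ)) μ := by
  obtain ⟨a, b, hab⟩ := φ.exists_le_add_mul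
  refine ⟨Measurable.of_discrete.aestronglyMeasurable, ?_⟩
  rw [HasFiniteIntegral]
  calc ∫⁻ i, ‖(h i : ℝ)‖ₑ ∂μ ≤ ∫⁻ i, (a + b * (φ (h i) : ℝ≥0∞)) ∂μ := by
        refine lintegral_mono fun i => ?_
        have h1 : ‖(h i : ℝ)‖ₑ = (h i : ℝ≥0∞) := by simp
        rw [h1]
        exact (ENNReal.coe_le_coe.2 (hab (h i))).trans_eq (by push_cast; rfl)
    _ = a + b * ∫⁻ i, (φ (h i) : ℝ≥0∞) ∂μ := by
        rw [lintegral_add_left measurable_const, lintegral_const_mul _ Measurable.of_discrete]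
        simp
    _ < ⊤ := ENNReal.add_lt_top.2 ⟨ENNReal.coe_lt_top, ENNReal.mul_lt_top ENNReal.coe_lt_top hh⟩

/-- The strong law of large numbers, along an arbitrary subsequence. -/
theorem tendsto_cesaroMeans_of_iIndepFun (hK : ∀ n, Measurable (K n))
    (hmap : ∀ n, volume.map (K n) = μ) (hind : iIndepFun K volume) {v : ℕ → ℝ}
    (hv : Integrable v μ) {k : ℕ → ℕ} (hk : StrictMono k) :
    ∀ᵐ t, Tendsto (cesaroMeans fun n => v (K (k n) t)) atTop (𝓝 (∫ i, v i ∂μ)) := by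
  have hvm : Measurable v := Measurable.of_discrete
  have h := strong_law_ae_real (μ := (volume : Measure unitInterval))
    (fun n t => v (K (k n) t)) ?_ ?_ ?_
  · have h1 : ∫ t, v (K (k 0) t) = ∫ i, v i ∂μ := by
      rw [← hmap (k 0), integral_map (hK _).aemeasurable hvm.aestronglyMeasurable]
    rw [h1] at h
    filter_upwards [h] with t ht
    exact tendsto_cesaroMeans_iff.2 ht
  · rw [← hmap (k 0)] at hv
    exact hv.comp_measurable (hK _)
  · intro i j hij
    exact (hind.indepFun (hk.injective.ne hij)).comp hvm hvm
  · intro i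
    refine ⟨(hvm.comp (hK _)).aemeasurable, (hvm.comp (hK _)).aemeasurable, ?_⟩
    change volume.map (v ∘ K (k i)) = volume.map (v ∘ K (k 0))
    rw [← Measure.map_map hvm (hK _), ← Measure.map_map hvm (hK _), hmap, hmap]

theorem tendsto_cesaroMeans_of_forall_norm_sub_le {E : Type*} [NormedAddCommGroup E]
    [NormedSpace ℝ E] {x : ℕ → E} {y : ℕ → ℕ → E} {δ : ℕ → ℝ} (hδ : Tendsto δ atTop (𝓝 0))
    (h : ∀ b n, ‖x n - y b n‖ ≤ δ b) (hy : ∀ b, Tendsto (cesaroMeans (y b)) atTop (𝓝 0)) :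
    Tendsto (cesaroMeans x) atTop (𝓝 0) := by
  rw [Metric.tendsto_atTop]
  intro ε hε
  obtain ⟨b, hb⟩ := (hδ.eventually (gt_mem_nhds (half_pos hε))).exists
  obtain ⟨N, hN⟩ := Metric.tendsto_atTop.1 (hy b) (ε / 2) (half_pos hε)
  refine ⟨N, fun m hm => ?_⟩
  have h1 := hN m hm
  have h2 := norm_cesaroMeans_le (h b) m
  rw [cesaroMeans_sub] at h2
  rw [dist_zero_right] at h1 ⊢
  have h3 := norm_add_le (cesaroMeans x m - cesaroMeans (y b) m) (cesaroMeans (y b) m)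
  rw [sub_add_cancel] at h3
  linarith

theorem exists_one_mem_heart : ∃ e : OrliczHeart φ,
    ((e : OrliczSpace φ) : L0) =ᵐ[volume] fun _ => (1 : ℝ) := by
  have h : ∫⁻ _ : unitInterval, (φ (‖(1 : ℝ)‖₊ / 1) : ℝ≥0∞) < ⊤ := by simp
  have h1 := coeFn_ofFun (φ := φ) (hg := aestronglyMeasurable_const) (h := ⟨1, one_pos, h⟩)
  refine ⟨⟨_, OrliczHeart.mem_of_bounded (K := 1) ?_⟩, h1⟩
  filter_upwards [h1] with x hx
  exact (congrArg abs hx).trans_le (by simp)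

theorem lintegral_comp_eq (hK : ∀ n, Measurable (K n)) (hmap : ∀ n, volume.map (K n) = μ) (n : ℕ)
    (F : ℕ → ℝ≥0∞) : ∫⁻ t, F (K n t) = ∫⁻ i, F i ∂μ := by
  rw [← hmap n, lintegral_map Measurable.of_discrete (hK n)]

theorem exists_mem_heart_coeFn_eq_comp (hK : ∀ n, Measurable (K n))
    (hmap : ∀ n, volume.map (K n) = μ) {h : ℕ → ℝ≥0}
    (hh : ∀ l : ℝ≥0, 0 < l → ∫⁻ i, (φ (h i / l) : ℝ≥0∞) ∂μ < ⊤) {v : ℕ → ℝ}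
    (hv : ∀ i, |v i| ≤ h i) (n : ℕ) :
    ∃ e : OrliczHeart φ, ((e : OrliczSpace φ) : L0) =ᵐ[volume] fun t => v (K n t) := by
  have hmod : ∀ l : ℝ≥0, 0 < l → ∫⁻ t, (φ (‖v (K n t)‖₊ / l) : ℝ≥0∞) < ⊤ := fun l hl => by
    refine lt_of_le_of_lt (lintegral_mono fun t => ENNReal.coe_le_coe.2 (φ.monotone
      (b := h (K n t) / l) ?_))
      ((lintegral_comp_eq hK hmap n fun i => (φ (h i / l) : ℝ≥0∞)).trans_lt (hh l hl))
    have : ‖v (K n t)‖₊ ≤ h (K n t) := hv _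
    gcongr
  have hm := ((Measurable.of_discrete (f := v)).comp (hK n)).aestronglyMeasurable (μ := volume)
  refine ⟨⟨ofFun (fun t => v (K n t)) hm ⟨1, one_pos, hmod 1 one_pos⟩, fun l hl => ?_⟩,
    coeFn_ofFun (hg := hm) (h := ⟨1, one_pos, hmod 1 one_pos⟩)⟩
  rw [modular_ofFun]
  exact hmod l hl

theorem norm_eq_of_coeFn_eq_comp (hK : ∀ n, Measurable (K n)) (hmap : ∀ n, volume.map (K n) = μ)
    {v : ℕ → ℝ} {e e' : OrliczHeart φ} {n n' : ℕ}
    (he : ((e : OrliczSpace φ) : L0) =ᵐ[volume] fun t => v (K n t))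
    (he' : ((e' : OrliczSpace φ) : L0) =ᵐ[volume] fun t => v (K n' t)) : ‖e‖ = ‖e'‖ := by
  have hm : ∀ {e : OrliczHeart φ} {n : ℕ}, ((e : OrliczSpace φ) : L0) =ᵐ[volume]
      (fun t => v (K n t)) → ∀ l, φ.modular l ((e : OrliczSpace φ) : L0) =
        ∫⁻ i, (φ (‖v i‖₊ / l) : ℝ≥0∞) ∂μ := fun {e n} he l => by
    rw [← lintegral_comp_eq hK hmap n]
    refine lintegral_congr_ae ?_
    filter_upwards [he] with t ht
    rw [ht]
  rw [Submodule.coe_norm, Submodule.coe_norm, norm_def, norm_def, OrliczFunction.luxNorm,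
    OrliczFunction.luxNorm]
  simp only [hm he, hm he']

theorem coeFn_cesaroMeans_heart (y : ℕ → OrliczHeart φ) :
    ∀ᵐ t, ∀ m, (((cesaroMeans y m : OrliczHeart φ) : OrliczSpace φ) : L0) t =
      cesaroMeans (fun n => ((y n : OrliczSpace φ) : L0) t) m := by
  refine ae_all_iff.2 fun m => ?_
  have h1 := map_cesaroMeans (OrliczHeart φ).subtype y m
  simp only [Submodule.subtype_apply] at h1
  rw [h1]
  filter_upwards [coeFn_cesaroMeans (fun n => (y n : OrliczSpace φ)) m] with t ht
  rw [ht, cesaroMeans_apply]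

/-- The averages of a bounded centred independent identically distributed sequence tend to zero in
the norm of `L^φ`. -/
theorem tendsto_cesaroMeans_heart_of_bounded [IsProbabilityMeasure μ] (hK : ∀ n, Measurable (K n))
    (hmap : ∀ n, volume.map (K n) = μ) (hind : iIndepFun K volume) {v : ℕ → ℝ} {b : ℝ}
    (hv0 : ∀ i, 0 ≤ v i) (hvb : ∀ i, v i ≤ b) {k : ℕ → ℕ} (hk : StrictMono k)
    {y : ℕ → OrliczHeart φ} (hy : ∀ n, ((y n : OrliczSpace φ) : L0) =ᵐ[volume]
      fun t => v (K (k n) t) - ∫ i, v i ∂μ) :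
    Tendsto (cesaroMeans y) atTop (𝓝 0) := by
  obtain ⟨e, he⟩ := exists_one_mem_heart (φ := φ)
  have hvint : Integrable v μ := Integrable.of_bound Measurable.of_discrete.aestronglyMeasurable b
    (ae_of_all _ fun i => by rw [Real.norm_of_nonneg (hv0 i)]; exact hvb i)
  have hI0 : 0 ≤ ∫ i, v i ∂μ := integral_nonneg fun i => hv0 i
  have hIb : ∫ i, v i ∂μ ≤ b := by
    have := integral_mono hvint (integrable_const b) hvb
    simpa using this
  have hpt : ∀ᵐ t, ∀ m, (((cesaroMeans y m : OrliczHeart φ) : OrliczSpace φ) : L0) t =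
      cesaroMeans (fun n => v (K (k n) t)) m - ∫ i, v i ∂μ := by
    filter_upwards [coeFn_cesaroMeans_heart y, ae_all_iff.2 hy] with t h1 h2 m
    rw [h1]
    simp only [h2]
    rw [cesaroMeans_sub, cesaroMeans_const]
  rw [tendsto_zero_iff_norm_tendsto_zero]
  refine OrliczHeart.tendsto_norm_zero (Z := ((b • e : OrliczHeart φ) : OrliczSpace φ))
    (v := fun m => ((cesaroMeans y m : OrliczHeart φ) : OrliczSpace φ)) (b • e).2 (fun m => ?_) ?_
  · filter_upwards [hpt, coeFn_smul' b (e : OrliczSpace φ), he] with t h1 h2 h3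
    have h4 : (((b • e : OrliczHeart φ) : OrliczSpace φ) : L0) t = b := by
      rw [h3, mul_one] at h2
      exact h2
    rw [h1, h4]
    have h5 : 0 ≤ cesaroMeans (fun n => v (K (k n) t)) m :=
      (cesaroMeans_const (0 : ℝ) m).symm.trans_le (cesaroMeans_mono (fun n => hv0 _) m)
    have h6 : cesaroMeans (fun n => v (K (k n) t)) m ≤ b :=
      (cesaroMeans_mono (fun n => hvb _) m).trans_eq (cesaroMeans_const b m)
    rw [abs_of_nonneg (hI0.trans hIb), abs_le]
    constructor <;> linarith
  · filter_upwards [hpt, tendsto_cesaroMeans_of_iIndepFun hK hmap hind hvint hk] with t h1 h2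
    simp only [h1]
    simpa using h2.sub_const (∫ i, v i ∂μ)

/-- A centred independent identically distributed sequence in the Orlicz heart is weakly null:
the averages of its truncations converge in norm, and the truncation error has the same norm for
all terms. -/
theorem exists_sigmaNull_of_iIndepFun [IsProbabilityMeasure μ] (hK : ∀ n, Measurable (K n))
    (hmap : ∀ n, volume.map (K n) = μ) (hind : iIndepFun K volume) {h : ℕ → ℝ≥0}
    (hh : ∀ l : ℝ≥0, 0 < l → ∫⁻ i, (φ (h i / l) : ℝ≥0∞) ∂μ < ⊤) :
    ∃ c : ℝ, ∃ x : ℕ → OrliczHeart φ,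
      (∀ n, ((x n : OrliczSpace φ) : L0) =ᵐ[volume] fun t => (h (K n t) : ℝ) - c) ∧
      SigmaNull (normDual (OrliczHeart φ)) x := by
  have hint : Integrable (fun i => (h i : ℝ)) μ :=
    integrable_of_modular_lt_top (φ := φ) (by simpa using hh 1 one_pos)
  obtain ⟨e, he⟩ := exists_one_mem_heart (φ := φ)
  -- the value and the truncation at level `b`
  let v : ℕ → ℕ → ℝ := fun b i => min (h i : ℝ) b
  have hv0 : ∀ b i, 0 ≤ v b i := fun b i => le_min (h i).2 (Nat.cast_nonneg b)
  have hself : ∀ i, |(h i : ℝ)| ≤ h i := fun i => by simp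
  have hv : ∀ b i, |v b i| ≤ h i := fun b i => by
    rw [abs_of_nonneg (hv0 b i)]
    exact min_le_left _ _
  have hv' : ∀ b i, |(h i : ℝ) - v b i| ≤ h i := fun b i => by
    rw [abs_of_nonneg (sub_nonneg.2 (min_le_left _ _))]
    linarith [hv0 b i]
  have hvlim : ∀ i, Tendsto (fun b => v b i) atTop (𝓝 (h i)) := fun i => by
    obtain ⟨N, hN⟩ := exists_nat_ge (h i : ℝ)
    refine tendsto_const_nhds.congr' ?_
    filter_upwards [eventually_ge_atTop N] with b hb
    exact (min_eq_left (hN.trans (by exact_mod_cast hb))).symm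
  choose E hE using fun n => exists_mem_heart_coeFn_eq_comp hK hmap hh hself n
  choose T hT using fun b n => exists_mem_heart_coeFn_eq_comp hK hmap hh (hv b) n
  choose S hS using fun b n => exists_mem_heart_coeFn_eq_comp hK hmap hh (hv' b) n
  set c : ℝ := ∫ i, (h i : ℝ) ∂μ with hc
  have hclim : Tendsto (fun b => ∫ i, v b i ∂μ) atTop (𝓝 c) :=
    tendsto_integral_of_dominated_convergence (fun i => (h i : ℝ))
      (fun b => Measurable.of_discrete.aestronglyMeasurable) hint
      (fun b => ae_of_all _ fun i => hv b i) (ae_of_all _ hvlim)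
  have herr : Tendsto (fun b => ‖S b 0‖) atTop (𝓝 0) := by
    refine OrliczHeart.tendsto_norm_zero (Z := E 0) (v := fun b => (S b 0 : OrliczSpace φ))
      (E 0).2 (fun b => ?_) ?_
    · filter_upwards [hS b 0, hE 0] with t h1 h2
      rw [h1, h2]
      exact (hv' b _).trans (le_abs_self _)
    · filter_upwards [ae_all_iff.2 fun b => hS b 0] with t h1
      simp only [h1]
      simpa using (hvlim (K 0 t)).const_sub (h (K 0 t) : ℝ)
  have hsub : ∀ (f : OrliczHeart φ) (a : ℝ), (((f - a • e : OrliczHeart φ) : OrliczSpace φ) : L0)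
      =ᵐ[volume] fun t => ((f : OrliczSpace φ) : L0) t - a := fun f a => by
    filter_upwards [coeFn_sub' (f : OrliczSpace φ) (a • (e : OrliczSpace φ)),
      coeFn_smul' a (e : OrliczSpace φ), he] with t h1 h2 h3
    rw [h2, h3, mul_one] at h1
    exact h1
  refine ⟨c, fun n => E n - c • e, fun n => ?_, fun g hg => ?_⟩
  · filter_upwards [hsub (E n) c, hE n] with t h1 h2
    rw [h1, h2]
  refine tendsto_zero_of_forall_subseq_tendsto_cesaroMeans fun k hk => ?_
  suffices hnorm : Tendsto (cesaroMeans fun n => E (k n) - c • e) atTop (𝓝 0) by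
    have h1 := (Continuous.tendsto hg 0).comp hnorm
    rw [map_zero] at h1
    refine h1.congr fun m => ?_
    rw [Function.comp_apply, map_cesaroMeans]
    rfl
  refine tendsto_cesaroMeans_of_forall_norm_sub_le
    (y := fun b n => T b (k n) - (∫ i, v b i ∂μ) • e)
    (δ := fun b => ‖S b 0‖ + |(∫ i, v b i ∂μ) - c| * ‖e‖) ?_ (fun b n => ?_) fun b => ?_
  · simpa using herr.add ((hclim.sub_const c).abs.mul_const ‖e‖)
  · have h1 : E (k n) - T b (k n) = S b (k n) := by
      refine Subtype.ext (Subtype.ext (AEEqFun.ext ?_))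
      filter_upwards [coeFn_sub' (E (k n) : OrliczSpace φ) (T b (k n) : OrliczSpace φ), hE (k n),
        hT b (k n), hS b (k n)] with t h1 h2 h3 h4
      rw [h2, h3] at h1
      rw [h4]
      exact h1
    have h2 : E (k n) - c • e - (T b (k n) - (∫ i, v b i ∂μ) • e) =
        S b (k n) + ((∫ i, v b i ∂μ) - c) • e := by
      rw [← h1, show ((∫ i, v b i ∂μ) - c) • e = (∫ i, v b i ∂μ) • e - c • e from
        sub_smul (R := ℝ) (M := OrliczHeart φ) _ _ e]
      abel
    have h3 : ‖S b 0‖ = ‖S b (k n)‖ :=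
      norm_eq_of_coeFn_eq_comp hK hmap (v := fun i => h i - v b i) (hS b 0) (hS b (k n))
    rw [h2, h3, ← Real.norm_eq_abs, ← norm_smul]
    exact norm_add_le _ _
  · refine tendsto_cesaroMeans_heart_of_bounded hK hmap hind (hv0 b) (b := b)
      (fun i => min_le_right _ _) hk fun n => ?_
    filter_upwards [hsub (T b (k n)) (∫ i, v b i ∂μ), hT b (k n)] with t h1 h2
    rw [h1, h2]

end IID

/-! ### Property `(H)` implies the growth condition -/

/-- A probability measure on `ℕ` with prescribed masses of the positive numbers, the remaining mass
being put at `0`. -/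
theorem exists_probabilityMeasure_singleton_succ {P : ℕ → ℝ≥0} (hP : ∑' i, (P i : ℝ≥0∞) ≤ 1) :
    ∃ μ : Measure ℕ, IsProbabilityMeasure μ ∧ (∀ i, μ {i + 1} = P i) ∧
      ∀ F : ℕ → ℝ≥0∞, ∫⁻ i, F i ∂μ ≤ F 0 + ∑' i, P i * F (i + 1) := by
  classical
  refine ⟨Measure.sum (fun i => (P i : ℝ≥0∞) • Measure.dirac (i + 1)) +
    (1 - ∑' i, (P i : ℝ≥0∞)) • Measure.dirac 0, ⟨?_⟩, fun i => ?_, fun F => ?_⟩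
  · rw [Measure.add_apply, Measure.sum_apply _ MeasurableSet.univ]
    simpa using add_tsub_cancel_of_le hP
  · rw [Measure.add_apply, Measure.sum_apply _ (measurableSet_singleton _), tsum_eq_single i]
    · simp
    · intro j hj
      simp [hj]
  · rw [lintegral_add_measure, lintegral_sum_measure, add_comm]
    simp only [lintegral_smul_measure, lintegral_dirac, smul_eq_mul]
    gcongr
    exact mul_le_of_le_one_left zero_le tsub_le_self

namespace OrliczFunction

variable {φ : OrliczFunction}

/-- If the growth condition fails, then there are points at which `φ` grows almost linearly over
intervals of the form `[t, L t]` with `L` as large as desired. -/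
theorem exists_of_not_nabla2 (h : ¬ φ.Nabla2) :
    ∃ (N : ℕ → ℕ) (t : ℕ → ℝ≥0), ∀ i, 1 ≤ N i ∧ 1 ≤ φ (t i) ∧
      4 * ((i : ℝ≥0) + 1) ^ 2 * 2 ^ (i + 1) <
        ∑ m ∈ Finset.range (N i), 1 / ((m : ℝ≥0) + 1) ∧
      φ (((i : ℝ≥0) + 1) ^ 2 * N i * t i) < 2 * (((i : ℝ≥0) + 1) ^ 2 * N i) * φ (t i) := by
  obtain ⟨τ, hτ⟩ := (φ.tendsto_atTop.eventually_ge_atTop 1).exists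
  have hN : ∀ i : ℕ, ∃ N : ℕ, 1 ≤ N ∧ 4 * ((i : ℝ≥0) + 1) ^ 2 * 2 ^ (i + 1) <
      ∑ m ∈ Finset.range N, 1 / ((m : ℝ≥0) + 1) := fun i => by
    obtain ⟨N, hN1, hN⟩ := ((eventually_ge_atTop 1).and
      (Real.tendsto_sum_range_one_div_nat_succ_atTop.eventually_gt_atTop
        (4 * ((i : ℝ) + 1) ^ 2 * 2 ^ (i + 1)))).exists
    refine ⟨N, hN1, ?_⟩
    rw [← NNReal.coe_lt_coe]
    push_cast
    exact hN
  choose N hN1 hN using hN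
  unfold Nabla2 at h
  push Not at h
  choose t ht1 ht using fun i : ℕ => h ((i + 1) ^ 2 * N i)
    (Nat.one_le_iff_ne_zero.2 (mul_ne_zero (by positivity) (Nat.one_le_iff_ne_zero.1 (hN1 i)))) τ
  refine ⟨N, t, fun i => ⟨hN1 i, hτ.trans (φ.monotone (ht1 i)), hN i, ?_⟩⟩
  have := ht i
  push_cast at this
  exact this

/-- The terms of a sequence with order bounded averages grow at most linearly. -/
theorem exists_forall_div_le {x : ℕ → OrliczSpace φ} (hx : OrderBounded (cesaroMeans x)) :
    ∃ R : OrliczSpace φ, ∀ᵐ t, ∀ m : ℕ, |(x m : L0) t| / (m + 1) ≤ (R : L0) t := by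
  obtain ⟨H, hH0, hH⟩ := hx
  refine ⟨(2 : ℝ) • H, ?_⟩
  filter_upwards [ae_all_iff.2 fun m => OrliczSpace.abs_le_iff_ae.1 (hH m),
    ae_all_iff.2 fun m => OrliczSpace.coeFn_cesaroMeans x m, OrliczSpace.nonneg_iff_ae.1 hH0,
    OrliczSpace.coeFn_smul' 2 H] with t h1 h2 h3 h4 m
  rw [h4, div_le_iff₀ (by positivity)]
  have hsum : ∀ m : ℕ, |∑ n ∈ Finset.range (m + 1), (x n : L0) t| ≤ (m + 1) * (H : L0) t :=
    fun m => by
    have h5 := h1 m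
    rw [h2 m] at h5
    have h6 : cesaroMeans (fun n => ((x n : L0) : unitInterval → ℝ)) m t =
        ((m : ℝ) + 1)⁻¹ * ∑ n ∈ Finset.range (m + 1), (x n : L0) t := by
      simp [cesaroMeans]
    rw [h6, abs_mul, abs_of_pos (by positivity : 0 < ((m : ℝ) + 1)⁻¹),
      inv_mul_le_iff₀ (by positivity)] at h5
    exact h5
  rcases m with _ | m
  · have := hsum 0
    simp at this ⊢
    linarith
  · have h5 := hsum (m + 1)
    have h6 := hsum m
    rw [Finset.sum_range_succ] at h5
    have h7 := abs_sub (∑ n ∈ Finset.range (m + 1), (x n : L0) t + (x (m + 1) : L0) t)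
      (∑ n ∈ Finset.range (m + 1), (x n : L0) t)
    rw [add_sub_cancel_left] at h7
    push_cast at h5 h6 h7 ⊢
    nlinarith

open ProbabilityTheory in
/-- Property `(H)` forces `φ` to grow faster than linearly in the sense of `∇₂`. Otherwise there is
a centred independent identically distributed sequence in the Orlicz heart for which
`sup |x n| / (n + 1)`, over any subsequence `x`, is not in `L^φ`. -/
theorem HasPropertyH.nabla2 (hH : φ.HasPropertyH) : φ.Nabla2 := by
  by_contra hnot
  obtain ⟨N, t, hNt⟩ := exists_of_not_nabla2 hnot
  set T : ℕ → ℝ≥0 := fun i => ((i : ℝ≥0) + 1) ^ 2 * N i * t i with hT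
  have hLT : ∀ i, (N i : ℝ≥0) ≤ φ (T i) := fun i => by
    obtain ⟨-, h1, -, -⟩ := hNt i
    have h2 := φ.natCast_mul_le ((i + 1) ^ 2 * N i) (t i)
    push_cast at h2
    calc (N i : ℝ≥0) = 1 * N i * 1 := by ring
      _ ≤ ((i : ℝ≥0) + 1) ^ 2 * N i * φ (t i) := by
          gcongr
          exact one_le_pow₀ (by simp)
      _ ≤ _ := h2
  have hφT : ∀ i, 1 ≤ φ (T i) := fun i => le_trans (by exact_mod_cast (hNt i).1) (hLT i)
  have hφT0 : ∀ i, φ (T i) ≠ 0 := fun i => (zero_lt_one.trans_le (hφT i)).ne'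
  set q : ℕ → ℝ≥0 := fun i => (1 / 2) ^ (i + 1) with hq
  have hqsum : ∑' i, (q i : ℝ≥0∞) = 1 := by
    have h1 : ∀ i, (q i : ℝ≥0∞) = 2⁻¹ ^ (i + 1) := fun i => by
      simp only [hq]
      push_cast
      rw [one_div]
    simp only [h1]
    rw [ENNReal.tsum_geometric_add_one]
    rw [ENNReal.one_sub_inv_two, inv_inv, ENNReal.inv_mul_cancel two_ne_zero (by simp)]
  -- the common law takes the value `T i / (i + 1)` with probability `P i`; the factor `1 / (i + 1)`
  -- puts it into the heart, and `P i` is chosen so that `∑ P i * φ (T i)` converges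
  set P : ℕ → ℝ≥0 := fun i => q i / φ (T i) with hPdef
  have hPq : ∀ i, P i ≤ q i := fun i => div_le_self zero_le (hφT i)
  obtain ⟨μ, hμ, hμP, hμF⟩ := exists_probabilityMeasure_singleton_succ (P := P)
    (((ENNReal.tsum_le_tsum fun i => ENNReal.coe_le_coe.2 (hPq i))).trans hqsum.le)
  set h : ℕ → ℝ≥0 := fun j => Nat.casesOn j 0 fun i => T i / (i + 1) with hh
  have hmod : ∀ l : ℝ≥0, 0 < l → ∫⁻ i, (φ (h i / l) : ℝ≥0∞) ∂μ < ⊤ := fun l hl => by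
    refine (hμF _).trans_lt (ENNReal.add_lt_top.2 ⟨ENNReal.coe_lt_top, ?_⟩)
    have hsum : Summable fun i => P i * φ (h (i + 1) / l) := by
      obtain ⟨n, hn⟩ := exists_nat_ge l⁻¹
      have hqs : Summable q := ENNReal.tsum_coe_ne_top_iff_summable.1 (by rw [hqsum]; simp)
      rw [← NNReal.summable_nat_add_iff n]
      refine NNReal.summable_of_le (fun i => ?_) ((NNReal.summable_nat_add_iff n).2 hqs)
      have h1 : h (i + n + 1) / l ≤ T (i + n) := by
        simp only [hh]
        rw [div_div]
        refine div_le_self zero_le ?_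
        calc (1 : ℝ≥0) = l⁻¹ * l := (inv_mul_cancel₀ hl.ne').symm
          _ ≤ _ := by
            gcongr
            refine hn.trans ?_
            push_cast
            rw [add_assoc, add_comm]
            exact le_add_right le_self_add
      calc P (i + n) * φ (h (i + n + 1) / l) ≤ P (i + n) * φ (T (i + n)) := by
            gcongr
            exact φ.monotone h1
        _ = q (i + n) := div_mul_cancel₀ _ (hφT0 _)
    have h2 := ENNReal.tsum_coe_ne_top_iff_summable.2 hsum
    push_cast at h2
    exact h2.lt_top
  obtain ⟨K, hK, hmap, hind⟩ := exists_iIndepFun_map_eq μ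
  obtain ⟨c, x, hx, hx0⟩ := exists_sigmaNull_of_iIndepFun hK hmap hind hmod
  obtain ⟨k, hk, hob⟩ := hH x hx0
  obtain ⟨R₀, hR₀⟩ := exists_forall_div_le hob
  obtain ⟨e, he⟩ := exists_one_mem_heart (φ := φ)
  obtain ⟨R, hR⟩ : ∃ R : OrliczSpace φ, ∀ᵐ s, ∀ m : ℕ, (h (K (k m) s) : ℝ) / (m + 1) ≤
      (R : L0) s := by
    refine ⟨R₀ + |c| • (e : OrliczSpace φ), ?_⟩
    filter_upwards [hR₀, ae_all_iff.2 hx, OrliczSpace.coeFn_add' R₀ (|c| • (e : OrliczSpace φ)),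
      OrliczSpace.coeFn_smul' |c| (e : OrliczSpace φ), he] with s h1 h2 h3 h4 h5 m
    rw [h3, h4, h5, mul_one]
    refine le_trans ?_ (add_le_add_left (h1 m) _)
    have hm : (0 : ℝ) < m + 1 := by positivity
    rw [h2, div_le_iff₀ hm, add_mul, div_mul_cancel₀ _ hm.ne']
    have h6 : |c| ≤ |c| * (m + 1) := le_mul_of_one_le_right (abs_nonneg c) (by simp)
    linarith [le_abs_self ((h (K (k m) s) : ℝ) - c), le_abs_self c]
  -- the bound `R`, at a scale `i + 1` above its norm, is tested on the events that the `m`-th term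
  -- of the subsequence takes the value `T i / (i + 1)`, for `m < N i`
  obtain ⟨i, hi⟩ := exists_nat_ge ‖R‖
  have hmodR : φ.modular (i + 1) (R : L0) ≤ 1 := OrliczSpace.modular_le_one (by
    push_cast
    linarith)
  obtain ⟨hN1, ht1, hNsum, hgrow⟩ := hNt i
  have hqi : q i ≤ 1 / 2 := by
    simp only [hq, pow_succ]
    exact mul_le_of_le_one_left zero_le (pow_le_one₀ zero_le (by norm_num))
  have hLpos : (0 : ℝ≥0) < ((i : ℝ≥0) + 1) ^ 2 * N i := by positivity
  have key := sum_le_lintegral_of_pairwise_indep (ν := (volume : Measure unitInterval))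
    (B := fun m => K (k m) ⁻¹' {i + 1}) (fun m => hK _ (measurableSet_singleton _)) (P := P i)
    (fun m => by rw [← Measure.map_apply (hK _) (measurableSet_singleton _), hmap, hμP])
    (fun m j hmj => by
      rw [(hind.indepFun (hk.injective.ne hmj)).measure_inter_preimage_eq_mul _ _
        (measurableSet_singleton _) (measurableSet_singleton _),
        ← Measure.map_apply (hK _) (measurableSet_singleton _),
        ← Measure.map_apply (hK _) (measurableSet_singleton _), hmap, hmap, hμP])
    (N := N i) (by
      calc (N i : ℝ≥0) * P i = N i / φ (T i) * q i := by simp only [hPdef]; ring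
        _ ≤ 1 * (1 / 2) := by
            gcongr
            exact div_le_one_of_le₀ (hLT i) zero_le
        _ = 1 / 2 := one_mul _)
    (ψ := fun s => (φ (‖(R : L0) s‖₊ / (i + 1)) : ℝ≥0∞))
    (a := fun m => ((N i / (m + 1) * φ (t i) : ℝ≥0) : ℝ≥0∞)) (fun m hm => by
      filter_upwards [hR] with s hs hsB
      refine ENNReal.coe_le_coe.2 ?_
      have hsB' : K (k m) s = i + 1 := hsB
      have h1 := hs m
      rw [hsB'] at h1
      have h2 : T i / (i + 1) / (m + 1) ≤ ‖(R : L0) s‖₊ := by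
        rw [← NNReal.coe_le_coe]
        push_cast
        refine le_trans ?_ (h1.trans (le_abs_self _))
        simp [hh]
      set d : ℝ≥0 := ((i : ℝ≥0) + 1) ^ 2 * (m + 1) with hd
      have h3 : T i / d ≤ ‖(R : L0) s‖₊ / (i + 1) := by
        calc T i / d = T i / (i + 1) / (m + 1) / (i + 1) := by
              rw [hd]
              field_simp
          _ ≤ _ := by gcongr
      refine le_trans ?_ (φ.monotone h3)
      -- the point `T i / d = (N i / (m + 1)) * t i` lies above `t i`
      have h4 : T i / d = N i / (m + 1) * t i := by
        simp only [hT, hd]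
        field_simp
      have h5 : (1 : ℝ≥0) ≤ N i / (m + 1) := by
        rw [one_le_div (by positivity)]
        exact_mod_cast hm
      have ht0 : t i ≠ 0 := fun h0 => by
        rw [h0, φ.map_zero] at ht1
        exact absurd ht1 (by simp)
      have h6 := φ.mul_map_le_mul_map (s := t i) (t := N i / (m + 1) * t i)
        (le_mul_of_one_le_left zero_le h5)
      rw [h4]
      refine le_of_mul_le_mul_left ?_ (pos_iff_ne_zero.2 ht0)
      calc t i * (N i / (m + 1) * φ (t i)) = N i / (m + 1) * t i * φ (t i) := by ring
        _ ≤ _ := h6)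
  have key2 := key.trans hmodR
  simp only [← ENNReal.coe_mul] at key2
  rw [← ENNReal.ofNNReal_finsetSum] at key2
  have key3 : ∑ m ∈ Finset.range (N i), P i / 2 * (N i / (m + 1) * φ (t i)) ≤ 1 := by
    exact_mod_cast key2
  have hA : 1 ≤ P i / 2 * (N i * φ (t i)) * (4 * ((i : ℝ≥0) + 1) ^ 2 * 2 ^ (i + 1)) := by
    have h1 : q i * 2 ^ (i + 1) = 1 := by
      simp only [hq]
      rw [← mul_pow]
      norm_num
    calc (1 : ℝ≥0) = φ (T i) / φ (T i) := (div_self (hφT0 i)).symm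
      _ ≤ 2 * (((i : ℝ≥0) + 1) ^ 2 * N i) * φ (t i) / φ (T i) := by gcongr
      _ = 2 * (((i : ℝ≥0) + 1) ^ 2 * N i) * φ (t i) / φ (T i) * (q i * 2 ^ (i + 1)) := by
          rw [h1, mul_one]
      _ = _ := by
          simp only [hPdef]
          ring
  have hApos : 0 < P i / 2 * (N i * φ (t i)) := by
    refine pos_iff_ne_zero.2 fun h0 => ?_
    rw [h0, zero_mul] at hA
    exact absurd hA (by simp)
  refine absurd key3 (not_le.2 (hA.trans_lt ?_))
  calc P i / 2 * (N i * φ (t i)) * (4 * ((i : ℝ≥0) + 1) ^ 2 * 2 ^ (i + 1))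
      < P i / 2 * (N i * φ (t i)) * ∑ m ∈ Finset.range (N i), 1 / ((m : ℝ≥0) + 1) := by gcongr
    _ = _ := by
        rw [Finset.mul_sum]
        refine Finset.sum_congr rfl fun m _ => ?_
        ring

end OrliczFunction

theorem theorem5p3 (φ : OrliczFunction) (hconj : ∀ s, φ.conj s ≠ ⊤) :
    [HasOBSP (OrliczSpace φ),
      HasSigmaOBSP (uoDual (OrliczSpace φ)),
      HasSigmaOBSP (orderContinuousDual (OrliczSpace φ)),
      HasSigmaOBSP (normDual (OrliczSpace φ)),
      φ.HasPropertyH].TFAE := by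
  tfae_have 1 → 2 := fun h f hf _ => h f hf
  tfae_have 2 → 3 := HasSigmaOBSP.mono OrliczSpace.uoDual_subset_orderContinuousDual
  tfae_have 3 → 4 := HasSigmaOBSP.mono OrliczSpace.orderContinuousDual_subset_normDual
  tfae_have 4 → 5 := OrliczFunction.HasPropertyH.of_hasSigmaOBSP
  tfae_have 5 → 1 := fun h => h.hasOBSP h.nabla2
  tfae_finish
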